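/- A weight is a non-negative, locally integrable function $w:\mathbb R\to[0,\infty)$; write $w(E)=\int_E w$ for measurable $E\subseteq\mathbb R$, and $w(a,b)=w((a,b))$. For a measurable function $f$ on $\mathbb R$ that is locally integrable, let $$\mathsf M^+f(x)=\sup_{h>0}\frac1h\int_x^{x+h}|f(t)|\,dt,\qquad \mathsf M^-f(x)=\sup_{h>0}\frac1h\int_{x-h}^{x}|f(t)|\,dt .$$ A weight $w$ belongs to the class $A_\infty^+$ if $$[w]_{A_\infty^+}=\sup_{a<b}\frac1{w(a,b)}\int_{(a,b)}\mathsf M^-\big(w\mathbf 1_{(a,b)}\big)(x)\,dx<+\infty,$$ where intervals with $w(a,b)=0$ are disregarded. For $\alpha\in(0,1)$ the sharp weighted tauberian constant of $\mathsf M^+$ is $$\mathsf C_w^+(\alpha)=\sup_{0<w(E)<+\infty}\frac1{w(E)}\,w\big(\{x\in\mathbb R:\mathsf M^+\mathbf 1_E(x)>\alpha\}\big)\in[0,+\infty],$$ the supremum being over measurable sets $E\subseteq\mathbb R$ (and equal to $0$ if there is no such $E$, that is, if $w=0$ almost everywhere). **Theorem 1.1.** Let $w$ be a non-negative, locally integrable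 function on the real line. The following are equivalent: (i) $w\in A_\infty^+$. (ii) There exist $\delta>0$, $K>0$ and $\alpha_1\in(0,1)$ such that $\mathsf C_w^+(\alpha)-1\le K(1-\alpha)^\delta$ for all $\alpha\in(\alpha_1,1)$. (iii) There exists $\alpha_o\in(0,1)$ such that $\mathsf C_w^+(\alpha_o)<+\infty$. -/

import Mathlib

open MeasureTheory Set Filter Topology

namespace OneSided

/-- The forward one-sided Hardy-Littlewood maximal function
`M⁺ f (x) = sup_{h > 0} (1 / h) ∫_x^{x+h} |f|`, with values in `[0, ∞]`. -/
noncomputable def maximalPlus (f : ℝ → ℝ) (x : ℝ) : ENNReal :=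
  ⨆ (h : ℝ) (_ : 0 < h), (∫⁻ t in Ioo x (x + h), ENNReal.ofReal |f t|) / ENNReal.ofReal h

/-- The backward one-sided Hardy-Littlewood maximal function
`M⁻ f (x) = sup_{h > 0} (1 / h) ∫_{x-h}^x |f|`, with values in `[0, ∞]`. -/
noncomputable def maximalMinus (f : ℝ → ℝ) (x : ℝ) : ENNReal :=
  ⨆ (h : ℝ) (_ : 0 < h), (∫⁻ t in Ioo (x - h) x, ENNReal.ofReal |f t|) / ENNReal.ofReal h

/-- The weighted measure `w(E) = ∫_E w` of a set, for a non-negative function `w`. -/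
noncomputable def mass (w : ℝ → ℝ) (E : Set ℝ) : ENNReal :=
  ∫⁻ t in E, ENNReal.ofReal (w t)

/-- The Fujii-Wilson constant
`[w]_{A_∞⁺} = sup_{a < b} (1 / w(a,b)) ∫_{(a,b)} M⁻(w 1_{(a,b)})`, with values in `[0, ∞]`.
If `w(a,b) = 0` then the integral vanishes too, and the quotient `0 / 0` is `0` in `ENNReal`,
so that such intervals do not contribute. -/
noncomputable def fujiiWilson (w : ℝ → ℝ) : ENNReal :=
  ⨆ (a : ℝ) (b : ℝ) (_ : a < b),
    (∫⁻ x in Ioo a b, maximalMinus ((Ioo a b).indicator w) x) / mass w (Ioo a b)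

/-- Membership of a weight `w` in the one-sided Muckenhoupt class `A_∞⁺`. -/
def MemAInftyPlus (w : ℝ → ℝ) : Prop := fujiiWilson w < ⊤

/-- The set `{x : M⁺ 1_E (x) > α}`. -/
def halo (α : ℝ) (E : Set ℝ) : Set ℝ :=
  {x | ENNReal.ofReal α < maximalPlus (E.indicator fun _ => (1 : ℝ)) x}

/-- The sharp weighted tauberian constant
`C_w⁺(α) = sup_{0 < w(E) < ∞} w({x : M⁺ 1_E (x) > α}) / w(E)`, with values in `[0, ∞]`. -/
noncomputable def tauberian (w : ℝ → ℝ) (α : ℝ) : ENNReal :=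
  ⨆ (E : Set ℝ) (_ : MeasurableSet E) (_ : 0 < mass w E) (_ : mass w E < ⊤),
    mass w (halo α E) / mass w E

end OneSided

/-! All three conditions are equivalent to one property of μ = w dx, `SparseBound`: there are ε, η <
1 such that a set F in (a, b) with density at most ε in every (x, b) has μ(F) ≤ η μ(a, b). This is a
one-sided form of the usual A_∞ condition; smallness of F is measured in all intervals that end at
b.

Everything rests on the rising sun lemma. At a right end point of a component of {M⁻ν > t} no
interval to the left has average above t; on a component (c, d) of {M⁺1_E > α} all intervals (x, d)
have E-density at least α. Thus components turn level sets into sparse sets.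

(i) gives the property: cut (a, b) into intervals shrinking geometrically towards b. If F is small
in one of them, relative to the gap that follows, then the part of F where M⁻ is high carries little
mass, by integrability of M⁻, and on the rest the density of μ is bounded.

The property gives (ii): it iterates to the pairs (ε^k, η^k), hence to a power law. On a component
(c, d) of the halo of E, the set (c, d) \ E is (1 - α)-sparse, so most of the mass of the halo lies
in E.

(iii) gives the property, as (a, b) lies in the halo of (a, b) \ F. The property gives (i), since
consecutive level sets of M⁻ at heights l ε^(-k) are sparse in each other and their masses decay
geometrically, up to a component touching b that is estimated separately. -/

namespace OneSided

variable {μ : Measure ℝ}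

/-! ### Level sets of one-sided maximal functions and the rising sun lemma -/

/-- The set where the backward maximal function of the measure `ν` exceeds `t`. -/
def backSet (ν : Measure ℝ) (t : ℝ) : Set ℝ := {x | ∃ y < x, t * (x - y) < ν.real (Ioo y x)}

/-- The set where the forward maximal function of the measure `ν` exceeds `t`. -/
def forwardSet (ν : Measure ℝ) (t : ℝ) : Set ℝ := {x | ∃ y > x, t * (y - x) < ν.real (Ioo x y)}

lemma notMem_backSet {ν : Measure ℝ} {t x : ℝ} :
    x ∉ backSet ν t ↔ ∀ y < x, ν.real (Ioo y x) ≤ t * (x - y) := by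
  simp [backSet]

lemma notMem_forwardSet {ν : Measure ℝ} {t x : ℝ} :
    x ∉ forwardSet ν t ↔ ∀ y > x, ν.real (Ioo x y) ≤ t * (y - x) := by
  simp [forwardSet]

lemma exists_continuous_primitive (ν : Measure ℝ) [IsLocallyFiniteMeasure ν] [NullSingletonClass ν] :
    ∃ V : ℝ → ℝ, Continuous V ∧ ∀ y x, y ≤ x → ν.real (Ioo y x) = V x - V y := by
  have hi : ∀ a b, IntervalIntegrable (fun _ : ℝ => (1 : ℝ)) ν a b := fun a b =>
    intervalIntegrable_const
  refine ⟨fun x => ∫ _ in (0 : ℝ)..x, (1 : ℝ) ∂ν, intervalIntegral.continuous_primitive hi 0, ?_⟩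
  intro y x hyx
  rw [intervalIntegral.integral_interval_sub_left (hi _ _) (hi _ _),
    intervalIntegral.integral_of_le hyx]
  simp [measureReal_def, Ioo_ae_eq_Ioc.measure_eq]

lemma isOpen_backSet (ν : Measure ℝ) [IsLocallyFiniteMeasure ν] [NullSingletonClass ν] (t : ℝ) :
    IsOpen (backSet ν t) := by
  obtain ⟨V, hV, hVν⟩ := exists_continuous_primitive ν
  have : backSet ν t = ⋃ y, Ioi y ∩ {x | t * (x - y) < V x - V y} := by
    ext x
    simp only [backSet, mem_ofPred_eq, mem_iUnion, mem_inter_iff, mem_Ioi]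
    exact exists_congr fun y => and_congr_right fun h => by rw [hVν y x h.le]
  rw [this]
  exact isOpen_iUnion fun y => isOpen_Ioi.inter (isOpen_lt (by fun_prop) (by fun_prop))

lemma isOpen_forwardSet (ν : Measure ℝ) [IsLocallyFiniteMeasure ν] [NullSingletonClass ν] (t : ℝ) :
    IsOpen (forwardSet ν t) := by
  obtain ⟨V, hV, hVν⟩ := exists_continuous_primitive ν
  have : forwardSet ν t = ⋃ y, Iio y ∩ {x | t * (y - x) < V y - V x} := by
    ext x
    simp only [forwardSet, mem_ofPred_eq, mem_iUnion, mem_inter_iff, mem_Iio]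
    exact exists_congr fun y => and_congr_right fun h => by rw [hVν x y (le_of_lt h)]
  rw [this]
  exact isOpen_iUnion fun y => isOpen_Iio.inter (isOpen_lt (by fun_prop) (by fun_prop))

/-- The rising sun lemma for the backward maximal function. -/
lemma mul_sub_le_of_Ioo_subset_backSet {ν : Measure ℝ} [IsLocallyFiniteMeasure ν] [NullSingletonClass ν]
    {t c d : ℝ} (hcd : c ≤ d) (hc : c ∉ backSet ν t) (h : Ioo c d ⊆ backSet ν t) :
    t * (d - c) ≤ ν.real (Ioo c d) := by
  obtain ⟨V, hV, hVν⟩ := exists_continuous_primitive ν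
  rcases hcd.eq_or_lt with rfl | hcd
  · simp
  rw [notMem_backSet] at hc
  -- A minimum of V u - t u over [c, x] at some z > c is impossible: z is in the level set, so a
  -- strictly smaller value occurs at some y < z. If y ≥ c this contradicts minimality, if y < c it
  -- contradicts `hc`.
  have key : ∀ x ∈ Ioo c d, V c - t * c ≤ V x - t * x := by
    intro x hx
    obtain ⟨z, hz, hmin⟩ := isCompact_Icc.exists_isMinOn (nonempty_Icc.2 hx.1.le)
      (f := fun u => V u - t * u) (by fun_prop)
    rcases hz.1.eq_or_lt with rfl | hcz
    · exact hmin (right_mem_Icc.2 hx.1.le)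
    exfalso
    obtain ⟨y, hyz, hy⟩ := h ⟨hcz, hz.2.trans_lt hx.2⟩
    rw [hVν _ _ hyz.le] at hy
    have h1 : V z - t * z ≤ V c - t * c := hmin (left_mem_Icc.2 hx.1.le)
    rcases lt_or_ge y c with hyc | hyc
    · have := hc y hyc
      rw [hVν _ _ hyc.le] at this
      linarith
    · have : V z - t * z ≤ V y - t * y := hmin ⟨hyc, hyz.le.trans hz.2⟩
      linarith
  have hlim : V c - t * c ≤ V d - t * d := by
    have hF : Continuous fun x => V x - t * x := by fun_prop
    refine ge_of_tendsto (hF.continuousAt.tendsto.mono_left (nhdsWithin_le_nhds (s := Iio d))) ?_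
    filter_upwards [Ioo_mem_nhdsLT hcd] with x hx using key x hx
  rw [hVν _ _ hcd.le]
  linarith

/-- The rising sun lemma for the forward maximal function. -/
lemma mul_sub_le_of_Ioo_subset_forwardSet {ν : Measure ℝ} [IsLocallyFiniteMeasure ν] [NullSingletonClass ν]
    {t c d x : ℝ} (hx : x ∈ Ico c d) (hd : d ∉ forwardSet ν t) (h : Ioo c d ⊆ forwardSet ν t) :
    t * (d - x) ≤ ν.real (Ioo x d) := by
  obtain ⟨V, hV, hVν⟩ := exists_continuous_primitive ν
  rw [notMem_forwardSet] at hd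
  have key : ∀ x ∈ Ioo c d, V x - t * x ≤ V d - t * d := by
    intro x hx
    obtain ⟨z, hz, hmax⟩ := isCompact_Icc.exists_isMaxOn (nonempty_Icc.2 hx.2.le)
      (f := fun u => V u - t * u) (by fun_prop)
    rcases hz.2.eq_or_lt with rfl | hzd
    · exact hmax (left_mem_Icc.2 hx.2.le)
    exfalso
    obtain ⟨y, hyz, hy⟩ := h ⟨hx.1.trans_le hz.1, hzd⟩
    rw [hVν _ _ (le_of_lt hyz)] at hy
    have h1 : V d - t * d ≤ V z - t * z := hmax (right_mem_Icc.2 hx.2.le)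
    rcases lt_or_ge d y with hyc | hyc
    · have := hd y hyc
      rw [hVν _ _ hyc.le] at this
      linarith
    · have : V y - t * y ≤ V z - t * z := hmax ⟨hz.1.trans (le_of_lt hyz), hyc⟩
      linarith
  have hlim : V x - t * x ≤ V d - t * d := by
    have hF : Continuous fun x => V x - t * x := by fun_prop
    refine le_of_tendsto (hF.continuousAt.tendsto.mono_left (nhdsWithin_le_nhds (s := Ioi x))) ?_
    filter_upwards [Ioo_mem_nhdsGT hx.2] with y hy using key y ⟨hx.1.trans_lt hy.1, hy.2⟩
  rw [hVν _ _ hx.2.le]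
  linarith

/-- An open bounded set is a countable disjoint union of intervals with end points outside of it;
hence an inequality between measures can be checked on these intervals. -/
lemma measure_le_of_forall_component {U : Set ℝ} (hU : IsOpen U) {A B : ℝ} (hAB : U ⊆ Ioo A B)
    (m₁ m₂ : Measure ℝ)
    (h : ∀ c d, c < d → Ioo c d ⊆ U → c ∉ U → d ∉ U → m₁ (Ioo c d) ≤ m₂ (Ioo c d)) :
    m₁ U ≤ m₂ U := by
  set S : Set (Set ℝ) := (fun x => connectedComponentIn U x) '' U with hS
  have hcomp : ∀ s ∈ S, ∃ c d, c < d ∧ s = Ioo c d ∧ c ∉ U ∧ d ∉ U := by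
    rintro _ ⟨x, hx, rfl⟩
    set s := connectedComponentIn U x with hs
    have hxs : x ∈ s := mem_connectedComponentIn hx
    have hsU : s ⊆ U := connectedComponentIn_subset U x
    have ho : IsOpen s := hU.connectedComponentIn
    have hpre : IsPreconnected s := isPreconnected_connectedComponentIn
    have hbb : BddBelow s := ⟨A, fun y hy => (hAB (hsU hy)).1.le⟩
    have hba : BddAbove s := ⟨B, fun y hy => (hAB (hsU hy)).2.le⟩
    have hc : sInf s ∉ s := fun hmem => by
      obtain ⟨y, hy, hys⟩ := (mem_nhdsLE_iff_exists_Ioc_subset (a := sInf s)).1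
        (mem_nhdsWithin_of_mem_nhds (ho.mem_nhds hmem))
      obtain ⟨z, hz⟩ := exists_between (show y < sInf s from hy)
      exact (csInf_le hbb (hys ⟨hz.1, hz.2.le⟩)).not_gt hz.2
    have hd : sSup s ∉ s := fun hmem => by
      obtain ⟨y, hy, hys⟩ := (mem_nhdsGE_iff_exists_Ico_subset (a := sSup s)).1
        (mem_nhdsWithin_of_mem_nhds (ho.mem_nhds hmem))
      obtain ⟨z, hz⟩ := exists_between (show sSup s < y from hy)
      exact (le_csSup hba (hys ⟨hz.1.le, hz.2⟩)).not_gt hz.1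
    have hlt : sInf s < x := (csInf_le hbb hxs).lt_of_ne fun e => hc (e ▸ hxs)
    have hgt : x < sSup s := (le_csSup hba hxs).lt_of_ne fun e => hd (e ▸ hxs)
    have heq : s = Ioo (sInf s) (sSup s) := by
      refine Subset.antisymm (fun y hy => ⟨(csInf_le hbb hy).lt_of_ne fun e => hc (e ▸ hy),
        (le_csSup hba hy).lt_of_ne fun e => hd (e ▸ hy)⟩) ?_
      exact IsConnected.Ioo_csInf_csSup_subset ⟨⟨x, hxs⟩, hpre⟩ hbb hba
    -- An end point belonging to U could be added to the component, against its maximality.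
    have key : ∀ e, e ∈ closure s → e ∉ s → e ∉ U := by
      intro e he hes heU
      have : insert e s ⊆ s := by
        rw [hs]
        refine IsPreconnected.subset_connectedComponentIn ?_ (mem_insert_of_mem _ hxs)
          (insert_subset heU hsU)
        exact hpre.subset_closure (subset_insert _ _) (insert_subset he subset_closure)
      exact hes (this (mem_insert _ _))
    exact ⟨_, _, hlt.trans hgt, heq, key _ (csInf_mem_closure ⟨x, hxs⟩ hbb) hc,
      key _ (csSup_mem_closure ⟨x, hxs⟩ hba) hd⟩
  have hSU : ⋃₀ S = U := by
    refine Subset.antisymm (sUnion_subset ?_) fun x hx =>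
      ⟨_, mem_image_of_mem _ hx, mem_connectedComponentIn hx⟩
    rintro _ ⟨x, hx, rfl⟩
    exact connectedComponentIn_subset U x
  have hdisj : S.PairwiseDisjoint id := by
    rintro _ ⟨x, hx, rfl⟩ _ ⟨y, hy, rfl⟩ hne
    refine Set.disjoint_left.2 fun z hzx hzy => hne ?_
    exact (connectedComponentIn_eq hzx).trans (connectedComponentIn_eq hzy).symm
  have hopen : ∀ s ∈ S, IsOpen s := by
    rintro _ ⟨x, hx, rfl⟩
    exact hU.connectedComponentIn
  have hcount : S.Countable := hdisj.countable_of_isOpen hopen (by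
    rintro _ ⟨x, hx, rfl⟩
    exact ⟨x, mem_connectedComponentIn hx⟩)
  rw [← hSU, measure_sUnion hcount hdisj fun s hs => (hopen s hs).measurableSet,
    measure_sUnion hcount hdisj fun s hs => (hopen s hs).measurableSet]
  refine ENNReal.tsum_le_tsum fun ⟨s, hs⟩ => ?_
  obtain ⟨c, d, hcd, rfl, hc, hd⟩ := hcomp s hs
  refine h c d hcd ?_ hc hd
  rw [← hSU]
  exact subset_sUnion_of_mem hs

/-- Outside of the set where its backward maximal function exceeds `T`, an absolutely continuous
measure is at most `T` times Lebesgue measure. -/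
lemma measure_le_of_disjoint_backSet {ν : Measure ℝ} [IsLocallyFiniteMeasure ν]
    (hν : ν ≪ volume) {T : ℝ} {A : Set ℝ} (hA : MeasurableSet A)
    (hd : Disjoint A (backSet ν T)) : ν A ≤ ENNReal.ofReal T * volume A := by
  -- Lebesgue differentiation along the left-sided intervals [y, x], whose averages are at most T
  -- off the level set.
  have h1 : ∀ᵐ x : ℝ, x ∈ A → ν.rnDeriv volume x ≤ ENNReal.ofReal T := by
    filter_upwards [(IsUnifLocDoublingMeasure.vitaliFamily (volume : Measure ℝ) 1).ae_tendsto_rnDeriv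
      ν] with x hx hxA
    have h2 := hx.comp (Real.tendsto_Icc_vitaliFamily_left x)
    refine le_of_tendsto h2 ?_
    filter_upwards [self_mem_nhdsWithin] with y hy
    have h3 := notMem_backSet.1 (Set.disjoint_left.1 hd hxA) y hy
    have hpos : (0 : ℝ) < x - y := sub_pos.2 hy
    have h4 : ν (Icc y x) = ν (Ioo y x) := (measure_congr (hν.ae_eq Ioo_ae_eq_Icc)).symm
    have hfin : ν (Ioo y x) ≠ ⊤ := measure_Ioo_lt_top.ne
    simp only [Function.comp_apply]
    rw [Real.volume_Icc, h4, ← ENNReal.ofReal_toReal hfin, ← measureReal_def,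
      ← ENNReal.ofReal_div_of_pos hpos]
    exact ENNReal.ofReal_le_ofReal ((div_le_iff₀ hpos).2 h3)
  rw [← Measure.withDensity_rnDeriv_eq ν volume hν, withDensity_apply _ hA]
  calc ∫⁻ x in A, ν.rnDeriv volume x ≤ ∫⁻ _ in A, ENNReal.ofReal T :=
        lintegral_mono_ae ((ae_restrict_iff' hA).2 h1)
    _ = _ := by simp

lemma ofReal_mul_le_of_real {μ₁ μ₂ : Measure ℝ} {A B : Set ℝ} {s t : ℝ} (hs : 0 ≤ s) (ht : 0 ≤ t)
    (hA : μ₁ A ≠ ⊤) (hB : μ₂ B ≠ ⊤) (h : s * μ₁.real A ≤ t * μ₂.real B) :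
    ENNReal.ofReal s * μ₁ A ≤ ENNReal.ofReal t * μ₂ B := by
  rw [← ENNReal.ofReal_toReal hA, ← ENNReal.ofReal_toReal hB, ← ENNReal.ofReal_mul hs,
    ← ENNReal.ofReal_mul ht]
  exact ENNReal.ofReal_le_ofReal h

lemma real_mul_le_of_ofReal {μ₁ μ₂ : Measure ℝ} {A B : Set ℝ} {s t : ℝ} (hs : 0 ≤ s) (ht : 0 ≤ t)
    (hB : μ₂ B ≠ ⊤) (h : ENNReal.ofReal s * μ₁ A ≤ ENNReal.ofReal t * μ₂ B) :
    s * μ₁.real A ≤ t * μ₂.real B := by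
  have := ENNReal.toReal_mono (ENNReal.mul_ne_top ENNReal.ofReal_ne_top hB) h
  rwa [ENNReal.toReal_mul, ENNReal.toReal_mul, ENNReal.toReal_ofReal hs,
    ENNReal.toReal_ofReal ht] at this

lemma measure_inter_Ioo_le_of_forall_component {U : Set ℝ} (hU : IsOpen U) {A B : ℝ} (hA : A ∉ U)
    (hB : B ∉ U) (m₁ m₂ : Measure ℝ)
    (h : ∀ c d, A ≤ c → c < d → d ≤ B → Ioo c d ⊆ U → c ∉ U → d ∉ U →
      m₁ (Ioo c d) ≤ m₂ (Ioo c d)) :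
    m₁ (U ∩ Ioo A B) ≤ m₂ (U ∩ Ioo A B) := by
  refine measure_le_of_forall_component (hU.inter isOpen_Ioo) inter_subset_right m₁ m₂ ?_
  intro c d hcd hsub hc hd
  obtain ⟨hAc, hdB⟩ := (Ioo_subset_Ioo_iff hcd).1 (hsub.trans inter_subset_right)
  refine h c d hAc hcd hdB (hsub.trans inter_subset_left) (fun hcU => hc ⟨hcU, ?_, ?_⟩)
    (fun hdU => hd ⟨hdU, ?_, ?_⟩)
  · exact hAc.lt_of_ne fun e => hA (e ▸ hcU)
  · exact hcd.trans_le hdB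
  · exact hAc.trans_lt hcd
  · exact hdB.lt_of_ne fun e => hB (e ▸ hdU)

lemma mul_volume_backSet_inter_Ioo_le {ν : Measure ℝ} [IsLocallyFiniteMeasure ν]
    [NullSingletonClass ν] {t c d : ℝ} (ht : 0 ≤ t) (hc : c ∉ backSet ν t) (hd : d ∉ backSet ν t) :
    ENNReal.ofReal t * volume (backSet ν t ∩ Ioo c d) ≤ ν (backSet ν t ∩ Ioo c d) := by
  have := measure_inter_Ioo_le_of_forall_component (isOpen_backSet ν t) hc hd
    (ENNReal.ofReal t • volume) ν ?_
  · simpa using this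
  intro c' d' _ hcd _ hsub hc' _
  have h1 := mul_sub_le_of_Ioo_subset_backSet hcd.le hc' hsub
  have := ofReal_mul_le_of_real (μ₁ := volume) (μ₂ := ν) (A := Ioo c' d') (B := Ioo c' d') ht
    zero_le_one measure_Ioo_lt_top.ne measure_Ioo_lt_top.ne
    (by rw [Real.volume_real_Ioo_of_le hcd.le]; linarith)
  simpa using this

lemma exists_last_notMem {U : Set ℝ} (hU : IsOpen U) {c x : ℝ} (hcx : c ≤ x) (hc : c ∉ U) :
    ∃ z ∈ Icc c x, z ∉ U ∧ Ioc z x ⊆ U := by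
  obtain ⟨z, hz, hmax⟩ := ((isCompact_Icc (a := c) (b := x)).diff hU).exists_isGreatest
    ⟨c, left_mem_Icc.2 hcx, hc⟩
  refine ⟨z, hz.1, hz.2, fun y hy => ?_⟩
  by_contra hyU
  exact (hmax ⟨⟨hz.1.1.trans hy.1.le, hy.2⟩, hyU⟩).not_gt hy.1

/-- Let z be the last point of [c, x] outside the level set. The rising sun lemma and the bound on
ν(z, d) give measure at most ρ (d - z) in (z, d). All of (z, x] is in the level set, and removing it
costs x - z ≥ ρ (x - z). -/
lemma volume_backSet_inter_Ioo_le {ν : Measure ℝ} [IsLocallyFiniteMeasure ν]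
    [NullSingletonClass ν] {t ρ c d x : ℝ} (ht : 0 < t) (hρ : ρ ≤ 1) (hc : c ∉ backSet ν t)
    (hd : d ∉ backSet ν t) (h : ∀ z ∈ Ico c d, ν.real (Ioo z d) ≤ ρ * t * (d - z))
    (hx : x ∈ Ico c d) : volume.real (backSet ν t ∩ Ioo x d) ≤ ρ * (d - x) := by
  obtain ⟨z, hz, hzU, hsub⟩ := exists_last_notMem (isOpen_backSet ν t) hx.1 hc
  have hzd : z < d := hz.2.trans_lt hx.2
  have h1 : t * volume.real (backSet ν t ∩ Ioo z d) ≤ ν.real (Ioo z d) := by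
    have := real_mul_le_of_ofReal (μ₁ := volume) (μ₂ := ν) (A := backSet ν t ∩ Ioo z d)
      (B := Ioo z d) ht.le zero_le_one measure_Ioo_lt_top.ne (by
        simpa using (mul_volume_backSet_inter_Ioo_le ht.le hzU hd).trans
          (measure_mono inter_subset_right))
    linarith
  have h2 : volume.real (backSet ν t ∩ Ioo z d) ≤ ρ * (d - z) := by
    refine le_of_mul_le_mul_left ?_ ht
    linarith [h z ⟨hz.1, hzd⟩]
  have h3 : (x - z) + volume.real (backSet ν t ∩ Ioo x d)
      ≤ volume.real (backSet ν t ∩ Ioo z d) := by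
    have hdis : Disjoint (Ioc z x) (backSet ν t ∩ Ioo x d) :=
      Set.disjoint_left.2 fun y hy hy' => hy.2.not_gt hy'.2.1
    rw [← Real.volume_real_Ioc_of_le hz.2, ← measureReal_union hdis
      ((isOpen_backSet ν t).inter isOpen_Ioo).measurableSet measure_Ioc_lt_top.ne
      (measure_ne_top_of_subset inter_subset_right measure_Ioo_lt_top.ne)]
    refine measureReal_mono (union_subset (fun y hy => ⟨hsub hy, hy.1, hy.2.trans_lt hx.2⟩)
      fun y hy => ⟨hy.1, hz.2.trans_lt hy.2.1, hy.2.2⟩)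
      (measure_ne_top_of_subset inter_subset_right measure_Ioo_lt_top.ne)
  nlinarith [hz.2, hx.2]

/-! ### Sparse sets and the self-improvement of their mass bound -/

/-- A measurable subset of `(a, b)` whose density in each `(x, b)` is at most `ε`. -/
structure Sparse (ε a b : ℝ) (F : Set ℝ) : Prop where
  measurableSet : MeasurableSet F
  subset : F ⊆ Ioo a b
  volume_le : ∀ x ∈ Ico a b, volume.real (F ∩ Ioo x b) ≤ ε * (b - x)

/-- Sparse sets carry at most the proportion `η` of the measure. -/
def SparseBound (μ : Measure ℝ) (ε η : ℝ) : Prop :=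
  ∀ a b F, a < b → Sparse ε a b F → μ.real F ≤ η * μ.real (Ioo a b)

lemma nullSingletonClass_of_absolutelyContinuous {μ : Measure ℝ} (hμ : μ ≪ volume) :
    NullSingletonClass μ := ⟨fun _ => hμ Real.volume_singleton⟩

/-- Right of b, an interval ending at x meets F only inside some (y', b) that is no longer, where
sparseness applies. Hence the level set of M⁻1_F stays inside (a, b). -/
lemma Sparse.notMem_backSet {ε δ a b : ℝ} {F : Set ℝ} (hF : Sparse ε a b F) (hab : a < b)
    (hδ : 0 ≤ δ) (hεδ : ε ≤ δ) {x : ℝ} (hx : x ∉ Ioo a b) :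
    x ∉ backSet (volume.restrict F) δ := by
  rw [OneSided.notMem_backSet]
  intro y hyx
  rw [measureReal_restrict_apply measurableSet_Ioo]
  have hnn : 0 ≤ δ * (x - y) := mul_nonneg hδ (sub_pos.2 hyx).le
  by_cases h : a < x ∧ y < b
  · have hbx : b ≤ x := by
      by_contra! hxb
      exact hx ⟨h.1, hxb⟩
    have hmax : max y a < b := max_lt h.2 hab
    calc volume.real (Ioo y x ∩ F) ≤ volume.real (F ∩ Ioo (max y a) b) := by
          refine measureReal_mono (fun z hz => ⟨hz.2, max_lt hz.1.1 (hF.subset hz.2).1,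
            (hF.subset hz.2).2⟩)
            (measure_ne_top_of_subset inter_subset_right measure_Ioo_lt_top.ne)
      _ ≤ ε * (b - max y a) := hF.volume_le _ ⟨le_max_right _ _, hmax⟩
      _ ≤ δ * (b - max y a) := mul_le_mul_of_nonneg_right hεδ (sub_pos.2 hmax).le
      _ ≤ δ * (x - y) := mul_le_mul_of_nonneg_left (by linarith [le_max_left y a]) hδ
  · have : Ioo y x ∩ F = ∅ := by
      refine eq_empty_of_forall_notMem fun z hz => h ?_
      have := hF.subset hz.2
      exact ⟨this.1.trans hz.1.2, hz.1.1.trans this.2⟩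
    simpa [this] using hnn

/-- Iteration of a bound for sparse sets. -/
lemma SparseBound.pow [IsLocallyFiniteMeasure μ] (hμ : μ ≪ volume) {ε η : ℝ} (hε : ε ∈ Ioo 0 1)
    (hη : 0 ≤ η) (h : SparseBound μ ε η) (k : ℕ) : SparseBound μ (ε ^ (k + 1)) (η ^ (k + 1)) := by
  induction k with
  | zero => simpa using h
  | succ k ih =>
    intro a b F hab hF
    set ν := (volume : Measure ℝ).restrict F with hν
    -- G = {M⁻1_F > ε} is inserted between F and (a, b). It is ε^(k+1)-sparse in (a, b), and F is
    -- ε-sparse in each component of G, so the two bounds multiply.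
    set G := backSet ν ε with hG
    have hGo : IsOpen G := isOpen_backSet ν ε
    have hle : ε ^ (k + 1 + 1) ≤ ε := by
      simpa using pow_le_pow_of_le_one hε.1.le hε.2.le (show 1 ≤ k + 1 + 1 by omega)
    have hGout : ∀ x, x ∉ Ioo a b → x ∉ G := fun x hx =>
      hF.notMem_backSet hab hε.1.le hle hx
    have ha : a ∉ G := hGout a (by simp)
    have hb : b ∉ G := hGout b (by simp)
    have hGsub : G ⊆ Ioo a b := fun x hx => by
      by_contra hx'
      exact hGout x hx' hx
    have hGsp : Sparse (ε ^ (k + 1)) a b G := by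
      refine ⟨hGo.measurableSet, hGsub, fun x hx => ?_⟩
      refine volume_backSet_inter_Ioo_le hε.1 (pow_le_one₀ hε.1.le hε.2.le) ha hb ?_ hx
      intro z hz
      rw [hν, measureReal_restrict_apply measurableSet_Ioo, inter_comm, ← pow_succ]
      exact hF.volume_le z hz
    have hGle := ih a b G hab hGsp
    have hvolF : volume F ≠ ⊤ := measure_ne_top_of_subset hF.subset measure_Ioo_lt_top.ne
    have hfin : ∀ s ⊆ Ioo a b, μ s ≠ ⊤ := fun s hs =>
      measure_ne_top_of_subset hs measure_Ioo_lt_top.ne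
    -- Off G the density of F is at most ε, so |F \ G| ≤ ε |F \ G| with ε < 1.
    have hdiff : μ (F \ G) = 0 := by
      refine hμ ?_
      have hm := hF.measurableSet.diff hGo.measurableSet
      have h1 := measure_le_of_disjoint_backSet (ν := ν) Measure.restrict_le_self.absolutelyContinuous
        hm disjoint_sdiff_left
      rw [hν, Measure.restrict_apply hm, inter_eq_left.2 sdiff_subset] at h1
      by_contra h0
      refine h1.not_gt ?_
      calc ENNReal.ofReal ε * volume (F \ G) < 1 * volume (F \ G) :=
            (ENNReal.mul_lt_mul_iff_left h0 (measure_ne_top_of_subset sdiff_subset hvolF)).2 (by simpa using hε.2)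
        _ = _ := one_mul _
    have hinter : μ (G ∩ Ioo a b ∩ F) ≤ ENNReal.ofReal η * μ G := by
      have := measure_inter_Ioo_le_of_forall_component hGo ha hb (μ.restrict F)
        (ENNReal.ofReal η • μ) ?_
      · rw [Measure.restrict_apply (hGo.inter isOpen_Ioo).measurableSet] at this
        simpa [inter_eq_left.2 hGsub] using this
      intro c d hac hcd hdb hsub hc hd
      rw [Measure.restrict_apply measurableSet_Ioo, Measure.smul_apply, smul_eq_mul,
        ← one_mul (μ (Ioo c d ∩ F)), ← ENNReal.ofReal_one]
      have hcd' : Ioo c d ⊆ Ioo a b := Ioo_subset_Ioo hac hdb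
      refine ofReal_mul_le_of_real zero_le_one hη (hfin _ (inter_subset_left.trans hcd'))
        (hfin _ hcd') ?_
      rw [one_mul]
      refine h c d (Ioo c d ∩ F) hcd ⟨measurableSet_Ioo.inter hF.measurableSet, inter_subset_left, ?_⟩
      intro x hx
      have h2 := OneSided.notMem_backSet.1 hd x hx.2
      rw [hν, measureReal_restrict_apply measurableSet_Ioo] at h2
      refine (measureReal_mono (s₂ := Ioo x d ∩ F) (fun y hy => ⟨hy.2, hy.1.2⟩) ?_).trans h2
      exact measure_ne_top_of_subset inter_subset_left measure_Ioo_lt_top.ne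
    have h3 : μ F ≤ ENNReal.ofReal η * μ G := by
      rw [inter_eq_left.2 hGsub, inter_comm] at hinter
      rw [← measure_inter_add_sdiff F hGo.measurableSet, hdiff, add_zero]
      exact hinter
    have h4 : μ.real F ≤ η * μ.real G := by
      have := real_mul_le_of_ofReal (s := 1) zero_le_one hη (hfin _ hGsub) (by simpa using h3)
      linarith
    calc μ.real F ≤ η * μ.real G := h4
      _ ≤ η * (η ^ (k + 1) * μ.real (Ioo a b)) := mul_le_mul_of_nonneg_left hGle hη
      _ = _ := by ring

/-! ### From sparse sets to the Tauberian estimate -/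

lemma halo_eq_forwardSet {E : Set ℝ} (hE : MeasurableSet E) {α : ℝ} (hα : 0 ≤ α) :
    halo α E = forwardSet (volume.restrict E) α := by
  have hint : ∀ x h : ℝ, ∫⁻ t in Ioo x (x + h), ENNReal.ofReal |E.indicator (fun _ => (1 : ℝ)) t|
      = ENNReal.ofReal ((volume.restrict E).real (Ioo x (x + h))) := by
    intro x h
    have : ∀ t, ENNReal.ofReal |E.indicator (fun _ => (1 : ℝ)) t| = E.indicator 1 t := by
      intro t
      by_cases ht : t ∈ E <;> simp [ht]
    simp_rw [this]
    rw [lintegral_indicator_one hE, Measure.restrict_apply hE, measureReal_def,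
      ENNReal.ofReal_toReal measure_Ioo_lt_top.ne, Measure.restrict_apply measurableSet_Ioo,
      inter_comm]
  ext x
  simp only [halo, maximalPlus, forwardSet, mem_ofPred_eq, lt_iSup_iff, hint]
  constructor
  · rintro ⟨h, hh, hlt⟩
    refine ⟨x + h, by simpa using hh, ?_⟩
    rw [← ENNReal.ofReal_div_of_pos hh, ENNReal.ofReal_lt_ofReal_iff_of_nonneg hα,
      lt_div_iff₀ hh] at hlt
    simpa using hlt
  · rintro ⟨y, hy, hlt⟩
    have hh : 0 < y - x := sub_pos.2 hy
    refine ⟨y - x, hh, ?_⟩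
    rw [← ENNReal.ofReal_div_of_pos hh, ENNReal.ofReal_lt_ofReal_iff_of_nonneg hα,
      lt_div_iff₀ hh]
    simpa using hlt

/-- On a component (c, d) of the halo, E fills at least the proportion α of every (x, d), so (c, d)
\ E is sparse and E keeps the proportion 1 - η of μ(c, d). Boundedness of E makes the components
bounded. -/
lemma SparseBound.measure_forwardSet_le_of_bounded [IsLocallyFiniteMeasure μ] {ε η α r : ℝ}
    (h : SparseBound μ ε η) (hη₁ : η ≤ 1) (hα : 0 < α) (hαε : 1 - α ≤ ε)
    {E : Set ℝ} (hE : MeasurableSet E) (hEr : E ⊆ Ioo (-r) r) :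
    ENNReal.ofReal (1 - η) * μ (forwardSet (volume.restrict E) α) ≤ μ E := by
  set U := forwardSet (volume.restrict E) α with hU
  have hUsub : U ⊆ Ioo (-r - 2 * r / α) r := by
    rintro x ⟨y, hxy, hy⟩
    rw [measureReal_restrict_apply measurableSet_Ioo] at hy
    have hxy' : 0 < y - x := sub_pos.2 hxy
    obtain ⟨z, hz⟩ : (Ioo x y ∩ E).Nonempty := by
      by_contra hne
      rw [not_nonempty_iff_eq_empty.1 hne, measureReal_empty] at hy
      exact (mul_pos hα hxy').not_gt hy
    have hzr := hEr hz.2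
    have h2 : volume.real (Ioo x y ∩ E) ≤ 2 * r := by
      refine (measureReal_mono (inter_subset_right.trans hEr) measure_Ioo_lt_top.ne).trans ?_
      rw [Real.volume_real_Ioo_of_le (hzr.1.trans hzr.2).le]
      linarith
    have h3 : y - x < 2 * r / α := by
      rw [lt_div_iff₀ hα]
      linarith
    exact ⟨by linarith [hzr.1, hz.1.2], hz.1.1.trans hzr.2⟩
  have := measure_le_of_forall_component (isOpen_forwardSet _ _) hUsub
    (ENNReal.ofReal (1 - η) • μ) (μ.restrict E) ?_
  · rw [Measure.smul_apply, smul_eq_mul] at this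
    exact this.trans ((measure_mono (subset_univ _)).trans (Measure.restrict_apply_univ E).le)
  intro c d hcd hsub hc hd
  rw [Measure.restrict_apply measurableSet_Ioo, Measure.smul_apply, smul_eq_mul,
    ← one_mul (μ (Ioo c d ∩ E)), ← ENNReal.ofReal_one]
  refine ofReal_mul_le_of_real (sub_nonneg.2 hη₁) zero_le_one measure_Ioo_lt_top.ne
    (measure_ne_top_of_subset inter_subset_left measure_Ioo_lt_top.ne) ?_
  have hsplit : ∀ (m : Measure ℝ) [IsLocallyFiniteMeasure m] (x : ℝ),
      m.real (Ioo x d ∩ E) + m.real (Ioo x d \ E) = m.real (Ioo x d) := fun m _ x =>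
    measureReal_inter_add_sdiff hE measure_Ioo_lt_top.ne
  have h1 := h c d (Ioo c d \ E) hcd ⟨measurableSet_Ioo.diff hE, sdiff_subset, fun x hx => ?_⟩
  · linarith [hsplit μ c]
  · have h2 := mul_sub_le_of_Ioo_subset_forwardSet hx hd hsub
    rw [measureReal_restrict_apply measurableSet_Ioo] at h2
    have h3 : volume.real (Ioo c d \ E ∩ Ioo x d) ≤ volume.real (Ioo x d \ E) :=
      measureReal_mono (fun y hy => ⟨hy.2, hy.1.2⟩)
        (measure_ne_top_of_subset sdiff_subset measure_Ioo_lt_top.ne)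
    have h4 := hsplit volume x
    rw [Real.volume_real_Ioo_of_le hx.2.le] at h4
    nlinarith [hx.2]

lemma SparseBound.measure_forwardSet_le [IsLocallyFiniteMeasure μ] {ε η α : ℝ}
    (h : SparseBound μ ε η) (hη₁ : η < 1) (hα : 0 < α) (hαε : 1 - α ≤ ε)
    {E : Set ℝ} (hE : MeasurableSet E) :
    μ (forwardSet (volume.restrict E) α) ≤ ENNReal.ofReal (1 - η)⁻¹ * μ E := by
  set En : ℕ → Set ℝ := fun n => E ∩ Ioo (-(n : ℝ)) n with hEn
  have hEnm : ∀ n, MeasurableSet (En n) := fun n => hE.inter measurableSet_Ioo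
  have hpos : 0 < 1 - η := sub_pos.2 hη₁
  have hsub : forwardSet (volume.restrict E) α ⊆ ⋃ n, forwardSet (volume.restrict (En n)) α := by
    rintro x ⟨y, hxy, hy⟩
    obtain ⟨n, hn⟩ := exists_nat_ge (max (-x) y)
    refine mem_iUnion.2 ⟨n, y, hxy, hy.trans_eq ?_⟩
    rw [measureReal_restrict_apply measurableSet_Ioo, measureReal_restrict_apply measurableSet_Ioo]
    congr 1
    ext z
    simp only [hEn, mem_inter_iff, mem_Ioo]
    refine ⟨fun hz => ⟨hz.1, hz.2, ?_, ?_⟩, fun hz => ⟨hz.1, hz.2.1⟩⟩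
    · linarith [hz.1.1, (le_max_left (-x) y).trans hn]
    · linarith [hz.1.2, (le_max_right (-x) y).trans hn]
  have hmono : Monotone fun n => forwardSet (volume.restrict (En n)) α := by
    rintro m n hmn x ⟨y, hxy, hy⟩
    refine ⟨y, hxy, hy.trans_le ?_⟩
    rw [measureReal_restrict_apply measurableSet_Ioo, measureReal_restrict_apply measurableSet_Ioo]
    have hmn' : (m : ℝ) ≤ n := Nat.cast_le.2 hmn
    refine measureReal_mono (inter_subset_inter_right _ (inter_subset_inter_right _
      (Ioo_subset_Ioo (neg_le_neg hmn') hmn')))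
      (measure_ne_top_of_subset inter_subset_left measure_Ioo_lt_top.ne)
  refine (measure_mono hsub).trans ?_
  rw [hmono.measure_iUnion]
  refine iSup_le fun n => ?_
  have := h.measure_forwardSet_le_of_bounded hη₁.le hα hαε (hEnm n)
    (inter_subset_right : En n ⊆ Ioo (-(n : ℝ)) n)
  rw [ENNReal.ofReal_inv_of_pos hpos, mul_comm, ← div_eq_mul_inv,
    ENNReal.le_div_iff_mul_le (Or.inl (by simpa using hpos)) (Or.inl ENNReal.ofReal_ne_top), mul_comm]
  exact this.trans (measure_mono inter_subset_left)

/-- The bound for sparse sets yields the sharp Tauberian estimate. -/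
lemma SparseBound.exists_rpow_bound [IsLocallyFiniteMeasure μ] (hμ : μ ≪ volume) {ε η : ℝ}
    (hε : ε ∈ Ioo 0 1) (hη : η ∈ Ioo 0 1) (h : SparseBound μ ε η) :
    ∃ δ : ℝ, 0 < δ ∧ ∃ K : ℝ, 0 < K ∧ ∀ᶠ α : ℝ in 𝓝[<] (1 : ℝ), 0 < α ∧ ∀ E, MeasurableSet E →
      μ (forwardSet (volume.restrict E) α) ≤ ENNReal.ofReal (1 + K * (1 - α) ^ δ) * μ E := by
  have hlogε : Real.log ε < 0 := Real.log_neg hε.1 hε.2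
  have hlogη : Real.log η < 0 := Real.log_neg hη.1 hη.2
  -- The exponent with ε^δ = η, so that η^k is the δ-th power of ε^k.
  set δ := Real.log η / Real.log ε with hδ
  have hδpos : 0 < δ := div_pos_of_neg_of_neg hlogη hlogε
  have hεδ : ε ^ δ = η := by
    rw [Real.rpow_def_of_pos hε.1, hδ, mul_div_cancel₀ _ hlogε.ne, Real.exp_log hη.1]
  set C := (ε ^ δ)⁻¹ with hC
  have hCpos : 0 < C := inv_pos.2 (Real.rpow_pos_of_pos hε.1 δ)
  have hbound : ∀ s : ℝ, 0 < s → s ≤ ε → SparseBound μ s (C * s ^ δ) := by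
    intro s hs hsε a b F hab hF
    -- Here ε^(k+1) < s / ε ≤ ε^k: the second bound makes s-sparse sets ε^(k+1)-sparse, the first
    -- gives η^(k+1) ≤ (s / ε)^δ.
    obtain ⟨k, hk₁, hk₂⟩ := exists_nat_pow_near_of_lt_one (x := s / ε) (div_pos hs hε.1)
      ((div_le_one hε.1).2 hsε) hε.1 hε.2
    have hk₃ : s ≤ ε ^ (k + 1) := by
      rw [pow_succ]
      exact (div_le_iff₀ hε.1).1 hk₂
    have h1 := h.pow hμ hε hη.1.le k a b F hab
      ⟨hF.measurableSet, hF.subset, fun x hx => (hF.volume_le x hx).trans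
        (mul_le_mul_of_nonneg_right hk₃ (sub_nonneg.2 hx.2.le))⟩
    refine h1.trans (mul_le_mul_of_nonneg_right ?_ measureReal_nonneg)
    calc η ^ (k + 1) = (ε ^ (k + 1)) ^ δ := by
          rw [← hεδ, ← Real.rpow_natCast, ← Real.rpow_natCast, ← Real.rpow_mul hε.1.le,
            ← Real.rpow_mul hε.1.le, mul_comm]
      _ ≤ (s / ε) ^ δ := Real.rpow_le_rpow (pow_pos hε.1 _).le hk₁.le hδpos.le
      _ = C * s ^ δ := by
          rw [Real.div_rpow hs.le hε.1.le, hC, div_eq_inv_mul]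
  have hlim : Tendsto (fun α : ℝ => C * (1 - α) ^ δ) (𝓝[<] 1) (𝓝 0) := by
    have : Continuous fun α : ℝ => C * (1 - α) ^ δ := by
      have := Real.continuous_rpow_const hδpos.le
      fun_prop
    have h0 := this.tendsto 1
    simp only [sub_self, Real.zero_rpow hδpos.ne', mul_zero] at h0
    exact h0.mono_left nhdsWithin_le_nhds
  -- The factor 2 comes from 1 / (1 - θ) ≤ 1 + 2θ for 0 ≤ θ ≤ 1/2.
  refine ⟨δ, hδpos, 2 * C, by positivity, ?_⟩
  filter_upwards [hlim.eventually_le_const (show (0 : ℝ) < 1 / 2 by norm_num), self_mem_nhdsWithin,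
    mem_nhdsWithin_of_mem_nhds (Ioi_mem_nhds (show (0 : ℝ) < 1 by norm_num)),
    mem_nhdsWithin_of_mem_nhds (Ioi_mem_nhds (show 1 - ε < 1 by linarith [hε.1]))]
    with α hα₁ hα₂ hα₃ hα₄
  refine ⟨hα₃, fun E hE => ?_⟩
  have hs : 0 < 1 - α := sub_pos.2 hα₂
  have hsε : 1 - α ≤ ε := by linarith [show 1 - ε < α from hα₄]
  set θ := C * (1 - α) ^ δ with hθ
  have hθpos : 0 ≤ θ := mul_nonneg hCpos.le (Real.rpow_nonneg hs.le δ)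
  refine ((hbound _ hs hsε).measure_forwardSet_le (by linarith) hα₃ le_rfl hE).trans ?_
  gcongr
  rw [mul_assoc, ← hθ]
  refine inv_le_of_inv_le₀ (by positivity) ?_
  rw [inv_le_iff_one_le_mul₀ (by positivity)]
  nlinarith

/-! ### From a Tauberian condition to the sparse bound -/

lemma exists_subset_Ioo_measureReal_eq [IsLocallyFiniteMeasure μ] [NullSingletonClass μ]
    {a b s : ℝ} (hab : a < b) (hs : s ∈ Icc 0 (μ.real (Ioo a b))) :
    ∃ y ∈ Icc a b, μ.real (Ioo a y) = s := by
  obtain ⟨V, hV, hVμ⟩ := exists_continuous_primitive μ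
  rw [hVμ a b hab.le] at hs
  obtain ⟨y, hy, hys⟩ := intermediate_value_Icc hab.le (hV.continuousOn (s := Icc a b))
    (show s + V a ∈ Icc (V a) (V b) from ⟨by linarith [hs.1], by linarith [hs.2]⟩)
  exact ⟨y, hy, by rw [hVμ a y hy.1, hys]; ring⟩

/-- A Tauberian condition implies the bound for sparse sets. -/
lemma exists_sparseBound_of_tauberian [IsLocallyFiniteMeasure μ] (hμ : μ ≪ volume) {α : ℝ}
    (hα : α ∈ Ioo 0 1) {C : ENNReal} (hC : C ≠ ⊤)
    (h : ∀ E, MeasurableSet E → 0 < μ E → μ E < ⊤ →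
      μ (forwardSet (volume.restrict E) α) ≤ C * μ E) :
    ∃ ε ∈ Ioo (0 : ℝ) 1, ∃ η ∈ Ioo (0 : ℝ) 1, SparseBound μ ε η := by
  have := nullSingletonClass_of_absolutelyContinuous hμ
  set c : ℝ := max C.toReal 2 with hc
  have hc2 : 2 ≤ c := le_max_right _ _
  have hCc : C ≤ ENNReal.ofReal c := by
    rw [← ENNReal.ofReal_toReal hC]
    exact ENNReal.ofReal_le_ofReal (le_max_left _ _)
  -- Half of 1 - α leaves (a, b) \ F with density above α, strictly, in every (x, b). Since c ≥ 2,
  -- the number 1 - c⁻¹ lies in (0, 1).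
  refine ⟨(1 - α) / 2, ⟨by linarith [hα.2], by linarith [hα.1]⟩, 1 - c⁻¹, ?_, ?_⟩
  · have h1 : c⁻¹ ≤ 2⁻¹ := inv_anti₀ (by norm_num) hc2
    have h2 : 0 < c⁻¹ := inv_pos.2 (by linarith)
    exact ⟨by linarith, by linarith⟩
  intro a b F hab hF
  have hfin : ∀ s ⊆ Ioo a b, μ s ≠ ⊤ := fun s hs => measure_ne_top_of_subset hs measure_Ioo_lt_top.ne
  -- The Tauberian hypothesis concerns only sets of positive mass. The extra set G serves the case
  -- where (a, b) \ F is null: an interval of mass μ(a, b) / (2c) is then added, which contradicts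
  -- the inequality.
  have key : ∀ G ⊆ Ioo a b, MeasurableSet G → 0 < μ.real (Ioo a b \ F ∪ G) →
      μ.real (Ioo a b) ≤ c * μ.real (Ioo a b \ F ∪ G) := by
    intro G hG hGm hpos
    have hEsub : Ioo a b \ F ∪ G ⊆ Ioo a b := union_subset sdiff_subset hG
    have hsub : Ioo a b ⊆ forwardSet (volume.restrict (Ioo a b \ F ∪ G)) α := by
      intro x hx
      refine ⟨b, hx.2, ?_⟩
      rw [measureReal_restrict_apply measurableSet_Ioo]
      have h1 := hF.volume_le x ⟨hx.1.le, hx.2⟩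
      have h2 := measureReal_inter_add_sdiff (μ := volume) (s := Ioo x b) hF.measurableSet
        measure_Ioo_lt_top.ne
      rw [Real.volume_real_Ioo_of_le hx.2.le, inter_comm] at h2
      have h3 : volume.real (Ioo x b \ F) ≤ volume.real (Ioo x b ∩ (Ioo a b \ F ∪ G)) :=
        measureReal_mono (fun y hy => ⟨hy.1, Or.inl ⟨⟨hx.1.trans hy.1.1, hy.1.2⟩, hy.2⟩⟩)
          (measure_ne_top_of_subset inter_subset_left measure_Ioo_lt_top.ne)
      nlinarith [hx.2, hα.2]
    have h1 := h (Ioo a b \ F ∪ G) ((measurableSet_Ioo.diff hF.measurableSet).union hGm)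
      (ENNReal.toReal_pos_iff.1 hpos).1 (hfin _ hEsub).lt_top
    have h2 := real_mul_le_of_ofReal (μ₁ := μ) (A := Ioo a b) zero_le_one
      (show 0 ≤ c by linarith) (hfin _ hEsub) (by
        rw [ENNReal.ofReal_one, one_mul]
        exact ((measure_mono hsub).trans h1).trans (mul_le_mul_left hCc _))
    simpa using h2
  have hsplit : μ.real F + μ.real (Ioo a b \ F) = μ.real (Ioo a b) := by
    rw [← measureReal_inter_add_sdiff (μ := μ) (s := Ioo a b) hF.measurableSet
      measure_Ioo_lt_top.ne, inter_eq_right.2 hF.subset]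
  have hmain : μ.real (Ioo a b) ≤ c * μ.real (Ioo a b \ F) := by
    rcases (measureReal_nonneg (μ := μ) (s := Ioo a b \ F)).eq_or_lt with h0 | hpos
    · rcases (measureReal_nonneg (μ := μ) (s := Ioo a b)).eq_or_lt with hI | hI
      · rw [← hI, ← h0, mul_zero]
      exfalso
      have hs : μ.real (Ioo a b) / (2 * c) ≤ μ.real (Ioo a b) :=
        div_le_self hI.le (by linarith)
      obtain ⟨y, hy, hys⟩ := exists_subset_Ioo_measureReal_eq (μ := μ) hab ⟨by positivity, hs⟩
      have hG : Ioo a y ⊆ Ioo a b := Ioo_subset_Ioo_right hy.2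
      have hU : μ.real (Ioo a b \ F ∪ Ioo a y) ≤ μ.real (Ioo a b) / (2 * c) := by
        rw [← hys]
        simpa [← h0] using measureReal_union_le (μ := μ) (Ioo a b \ F) (Ioo a y)
      have hU' : 0 < μ.real (Ioo a b \ F ∪ Ioo a y) := by
        refine lt_of_lt_of_le (b := μ.real (Ioo a y)) ?_ (measureReal_mono subset_union_right
          (hfin _ (union_subset sdiff_subset hG)))
        rw [hys]
        positivity
      have h1 := key _ hG measurableSet_Ioo hU'
      have h2 : c * (μ.real (Ioo a b) / (2 * c)) = μ.real (Ioo a b) / 2 := by field_simp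
      nlinarith
    · have := key ∅ (empty_subset _) MeasurableSet.empty (by simpa using hpos)
      simpa using this
  have hcpos : 0 < c := by linarith
  have : c⁻¹ * μ.real (Ioo a b) ≤ μ.real (Ioo a b \ F) := by
    rw [inv_mul_le_iff₀ hcpos]
    exact hmain
  linarith

/-! ### From the sparse bound to integrability of the backward maximal function -/

/-- The backward maximal function of a measure. -/
noncomputable def backMax (ν : Measure ℝ) (x : ℝ) : ENNReal :=
  ⨆ (h : ℝ) (_ : 0 < h), ν (Ioo (x - h) x) / ENNReal.ofReal h

lemma lt_backMax_iff {ν : Measure ℝ} [IsLocallyFiniteMeasure ν] {t x : ℝ} (ht : 0 ≤ t) :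
    ENNReal.ofReal t < backMax ν x ↔ x ∈ backSet ν t := by
  have hν : ∀ y x, ν (Ioo y x) = ENNReal.ofReal (ν.real (Ioo y x)) := fun y x => by
    rw [measureReal_def, ENNReal.ofReal_toReal measure_Ioo_lt_top.ne]
  simp only [backMax, backSet, mem_ofPred_eq, lt_iSup_iff, hν]
  constructor
  · rintro ⟨h, hh, hlt⟩
    refine ⟨x - h, by linarith, ?_⟩
    rw [← ENNReal.ofReal_div_of_pos hh, ENNReal.ofReal_lt_ofReal_iff_of_nonneg ht,
      lt_div_iff₀ hh] at hlt
    simpa using hlt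
  · rintro ⟨y, hy, hlt⟩
    have hh : 0 < x - y := sub_pos.2 hy
    refine ⟨x - y, hh, ?_⟩
    rw [← ENNReal.ofReal_div_of_pos hh, ENNReal.ofReal_lt_ofReal_iff_of_nonneg ht,
      lt_div_iff₀ hh]
    simpa using hlt

lemma backSet_anti {ν : Measure ℝ} {s t : ℝ} (hst : s ≤ t) : backSet ν t ⊆ backSet ν s := by
  rintro x ⟨y, hy, h⟩
  exact ⟨y, hy, (mul_le_mul_of_nonneg_right hst (sub_pos.2 hy).le).trans_lt h⟩

lemma notMem_backSet_of_le {a b t x : ℝ} (ht : 0 ≤ t) (hx : x ≤ a) :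
    x ∉ backSet (μ.restrict (Ioo a b)) t := by
  rw [notMem_backSet]
  intro y hy
  have : Ioo y x ∩ Ioo a b = ∅ :=
    eq_empty_of_forall_notMem fun z hz => (hz.1.2.trans_le hx).not_gt hz.2.1
  rw [measureReal_restrict_apply measurableSet_Ioo, this, measureReal_empty]
  exact mul_nonneg ht (sub_pos.2 hy).le

section Levels

variable [IsLocallyFiniteMeasure μ] {ε η : ℝ}

/-- Data of the level sets of the backward maximal function of `μ` restricted to `(a, b)`: for
each level the last point `c k` of `[a, b]` which does not belong to the level set. -/
lemma exists_levels [NullSingletonClass μ] (hε : ε ∈ Ioo 0 1) (hη : η ∈ Ioo 0 1)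
    (h : SparseBound μ ε η) {a b l : ℝ} (hab : a < b) (hl : 0 < l) :
    ∃ c : ℕ → ℝ, Monotone c ∧ (∀ k, c k ∈ Icc a b) ∧
      (∀ k, c k ∉ backSet (μ.restrict (Ioo a b)) (l * ε⁻¹ ^ k)) ∧
      (∀ k, Ioo (c k) b ⊆ backSet (μ.restrict (Ioo a b)) (l * ε⁻¹ ^ k)) ∧
      ∀ k, μ (backSet (μ.restrict (Ioo a b)) (l * ε⁻¹ ^ (k + 1)) ∩ Ioo a (c (k + 1))) ≤
        ENNReal.ofReal η * μ (backSet (μ.restrict (Ioo a b)) (l * ε⁻¹ ^ k) ∩ Ioo a (c k)) +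
          μ (Ico (c k) (c (k + 1))) := by
  set ν := μ.restrict (Ioo a b) with hν
  set t : ℕ → ℝ := fun k => l * ε⁻¹ ^ k with ht
  have hε' : 1 ≤ ε⁻¹ := (one_le_inv₀ hε.1).2 hε.2.le
  have htpos : ∀ k, 0 < t k := fun k => mul_pos hl (pow_pos (by linarith) k)
  have htmono : Monotone t := fun m n hmn =>
    mul_le_mul_of_nonneg_left (pow_le_pow_right₀ hε' hmn) hl.le
  have htsucc : ∀ k, ε * t (k + 1) = t k := fun k => by
    have := hε.1.ne'
    simp only [ht, pow_succ]
    field_simp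
  have ha : ∀ k, a ∉ backSet ν (t k) := fun k => notMem_backSet_of_le (htpos k).le le_rfl
  choose c hcI hc hcsub using fun k => exists_last_notMem (isOpen_backSet ν (t k)) hab.le (ha k)
  have hcmono : Monotone c := monotone_nat_of_le_succ fun k => by
    by_contra! hlt
    exact hc (k + 1) (absurd (backSet_anti (htmono k.le_succ) (hcsub (k + 1) ⟨hlt, (hcI k).2⟩)) (hc k))
  refine ⟨c, hcmono, hcI, hc, fun k => Ioo_subset_Ioc_self.trans (hcsub k), fun k => ?_⟩
  set N : ℕ → Set ℝ := fun k => backSet ν (t k) ∩ Ioo a (c k) with hN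
  have hNo : ∀ k, IsOpen (N k) := fun k => (isOpen_backSet _ _).inter isOpen_Ioo
  have hsub : N (k + 1) ⊆ N k ∩ N (k + 1) ∪ Ico (c k) (c (k + 1)) := by
    intro x hx
    rcases lt_or_ge x (c k) with hlt | hge
    · exact Or.inl ⟨⟨backSet_anti (htmono k.le_succ) hx.1, hx.2.1, hlt⟩, hx⟩
    · exact Or.inr ⟨hge, hx.2.2⟩
  refine (measure_mono hsub).trans ((measure_union_le _ _).trans (add_le_add_left ?_ _))
  -- At the right end point of a component of level k, averages to the left are at most t k = ε t (k
  -- + 1); hence level k + 1 is ε-sparse in that component. Stopping at c k excludes the component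
  -- that may run past b.
  have := measure_inter_Ioo_le_of_forall_component (isOpen_backSet ν (t k)) (ha k) (hc k)
    (μ.restrict (N (k + 1))) (ENNReal.ofReal η • μ) ?_
  · rwa [Measure.restrict_apply (hNo k).measurableSet] at this
  intro x d hax hxd hdc hsub' hx hd
  have hdb : d ≤ b := hdc.trans (hcI k).2
  rw [Measure.restrict_apply measurableSet_Ioo, Measure.smul_apply, smul_eq_mul,
    ← one_mul (μ (Ioo x d ∩ N (k + 1))), ← ENNReal.ofReal_one]
  refine ofReal_mul_le_of_real zero_le_one hη.1.le
    (measure_ne_top_of_subset inter_subset_left measure_Ioo_lt_top.ne) measure_Ioo_lt_top.ne ?_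
  rw [one_mul]
  refine h x d _ hxd ⟨measurableSet_Ioo.inter (hNo _).measurableSet, inter_subset_left, ?_⟩
  intro y hy
  have hanti := backSet_anti (ν := ν) (htmono k.le_succ)
  have h1 := volume_backSet_inter_Ioo_le (ρ := ε) (htpos (k + 1)) hε.2.le (fun h' => hx (hanti h'))
    (fun h' => hd (hanti h')) (fun z hz => by
      rw [htsucc]
      exact notMem_backSet.1 hd z hz.2) hy
  refine (measureReal_mono (s₂ := backSet ν (t (k + 1)) ∩ Ioo y d)
    (fun z hz => ⟨hz.1.2.1, hz.2⟩) ?_).trans h1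
  exact measure_ne_top_of_subset inter_subset_right measure_Ioo_lt_top.ne

end Levels

/-- Summation gives S ≤ η S + 2T, and 2T / (1 - η) is the fixed point. Induction on partial sums
avoids subtracting a possibly infinite S. -/
lemma tsum_le_of_le_mul_add {s u : ℕ → ENNReal} {T : ENNReal} {η : ℝ} (hη : η ∈ Ioo 0 1)
    (hT : T ≠ ⊤) (h0 : s 0 ≤ T) (hs : ∀ k, s (k + 1) ≤ ENNReal.ofReal η * s k + u k)
    (hu : ∑' k, u k ≤ T) : ∑' k, s k ≤ ENNReal.ofReal (2 / (1 - η)) * T := by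
  have hpos : 0 < 1 - η := sub_pos.2 hη.2
  refine ENNReal.tsum_le_of_sum_range_le fun n => ?_
  induction n with
  | zero => simp
  | succ n ih =>
    rw [Finset.sum_range_succ']
    calc ∑ k ∈ Finset.range n, s (k + 1) + s 0
        ≤ ∑ k ∈ Finset.range n, (ENNReal.ofReal η * s k + u k) + T :=
          add_le_add (Finset.sum_le_sum fun k _ => hs k) h0
      _ = ENNReal.ofReal η * ∑ k ∈ Finset.range n, s k + ∑ k ∈ Finset.range n, u k + T := by
          rw [Finset.sum_add_distrib, Finset.mul_sum]
      _ ≤ ENNReal.ofReal η * (ENNReal.ofReal (2 / (1 - η)) * T) + T + T := by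
          gcongr
          exact (ENNReal.sum_le_tsum _).trans hu
      _ = ENNReal.ofReal (2 / (1 - η)) * T := by
          obtain ⟨r, hr, rfl⟩ : ∃ r : ℝ, 0 ≤ r ∧ T = ENNReal.ofReal r :=
            ⟨T.toReal, ENNReal.toReal_nonneg, (ENNReal.ofReal_toReal hT).symm⟩
          have h2 : 0 ≤ 2 / (1 - η) := by positivity
          rw [← ENNReal.ofReal_mul h2, ← ENNReal.ofReal_mul hη.1.le,
            ← ENNReal.ofReal_add (mul_nonneg hη.1.le (mul_nonneg h2 hr)) hr,
            ← ENNReal.ofReal_add (add_nonneg (mul_nonneg hη.1.le (mul_nonneg h2 hr)) hr) hr]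
          congr 1
          field_simp
          ring

/-- The bound for sparse sets controls the integral of the local backward maximal function. -/
lemma SparseBound.lintegral_backMax_le [IsLocallyFiniteMeasure μ] [NullSingletonClass μ]
    {ε η : ℝ} (hε : ε ∈ Ioo 0 1) (hη : η ∈ Ioo 0 1) (h : SparseBound μ ε η) {a b : ℝ}
    (hab : a < b) :
    ∫⁻ x in Ioo a b, backMax (μ.restrict (Ioo a b)) x ≤
      (1 + ENNReal.ofReal ε⁻¹ * (ENNReal.ofReal (2 / (1 - η)) + 1)) * μ (Ioo a b) := by
  set ν := μ.restrict (Ioo a b) with hν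
  rcases eq_or_ne (μ (Ioo a b)) 0 with h0 | h0
  · have hν0 : ν = 0 := Measure.restrict_eq_zero.2 h0
    simp [backMax, hν0]
  have hfin : μ (Ioo a b) ≠ ⊤ := measure_Ioo_lt_top.ne
  have hba : 0 < b - a := sub_pos.2 hab
  set l : ℝ := μ.real (Ioo a b) / (b - a) with hl
  have hlpos : 0 < l := div_pos (ENNReal.toReal_pos h0 hfin) hba
  obtain ⟨c, hcmono, hcI, hc, hcsub, hstep⟩ := exists_levels hε hη h hab hlpos
  rw [← hν] at hc hcsub hstep
  set t : ℕ → ℝ := fun k => l * ε⁻¹ ^ k with ht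
  set N : ℕ → Set ℝ := fun k => backSet ν (t k) ∩ Ioo a (c k) with hN
  have hε' : 1 < ε⁻¹ := (one_lt_inv₀ hε.1).2 hε.2
  have htpos : ∀ k, 0 < t k := fun k => mul_pos hlpos (pow_pos (by linarith) k)
  have htsucc : ∀ k, t (k + 1) = ε⁻¹ * t k := fun k => by
    simp only [ht, pow_succ]
    ring
  have httop : Tendsto t atTop atTop :=
    (tendsto_pow_atTop_atTop_of_one_lt hε').const_mul_atTop hlpos
  have hNo : ∀ k, IsOpen (N k) := fun k => (isOpen_backSet _ _).inter isOpen_Ioo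
  have hνle : ∀ s, ν s ≤ μ s := fun s => Measure.restrict_le_self s
  have htN : ∀ k, ENNReal.ofReal (t k) * volume (N k) ≤ μ (N k) := fun k =>
    (mul_volume_backSet_inter_Ioo_le (htpos k).le (notMem_backSet_of_le (htpos k).le le_rfl)
      (hc k)).trans (hνle _)
  have hlast : ∀ k d, c k ≤ d → d ≤ b → t k * (d - c k) ≤ ν.real (Ioo (c k) d) := fun k d h1 h2 =>
    mul_sub_le_of_Ioo_subset_backSet h1 (hc k) ((Ioo_subset_Ioo_right h2).trans (hcsub k))
  have htc : ∀ k, ENNReal.ofReal (t k) * volume (Icc (c k) (c (k + 1))) ≤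
      μ (Ico (c k) (c (k + 1))) := by
    intro k
    have hck := hcmono k.le_succ
    have h1 := ofReal_mul_le_of_real (μ₁ := volume) (μ₂ := ν) (A := Ioo (c k) (c (k + 1)))
      (B := Ioo (c k) (c (k + 1))) (htpos k).le zero_le_one measure_Ioo_lt_top.ne
      measure_Ioo_lt_top.ne
      (by rw [Real.volume_real_Ioo_of_le hck, one_mul]; exact hlast k _ hck (hcI _).2)
    rw [ENNReal.ofReal_one, one_mul, Ioo_ae_eq_Icc.measure_eq] at h1
    exact h1.trans ((hνle _).trans (measure_mono Ioo_subset_Ico_self))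
  have hcb : ∀ x < b, ∀ᶠ k in atTop, x < c k := by
    intro x hx
    filter_upwards [httop.eventually_gt_atTop (ν.real (Ioo a b) / (b - x))] with k hk
    rw [div_lt_iff₀ (sub_pos.2 hx)] at hk
    by_contra! hle
    have h1 := hlast k b (hcI k).2 le_rfl
    have h2 : ν.real (Ioo (c k) b) ≤ ν.real (Ioo a b) :=
      measureReal_mono (Ioo_subset_Ioo_left (hcI k).1) measure_Ioo_lt_top.ne
    nlinarith [htpos k]
  -- Let k be the first level whose set misses x, so M⁻ ≤ t k. If k = m + 1, then x is in level m:
  -- either x < c m and x is in N m, or x lies in [c m, c (m + 1)], because everything in (c (m +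
  -- 1), b) belongs to level m + 1.
  have hpt : ∀ x ∈ Ioo a b, backMax ν x ≤ ENNReal.ofReal l +
      (∑' k, ENNReal.ofReal (t (k + 1)) * (N k).indicator 1 x +
        ∑' k, ENNReal.ofReal (t (k + 1)) * (Icc (c k) (c (k + 1))).indicator 1 x) := by
    intro x hx
    set S₁ := ∑' k, ENNReal.ofReal (t (k + 1)) * (N k).indicator 1 x with hS₁
    set S₂ := ∑' k, ENNReal.ofReal (t (k + 1)) * (Icc (c k) (c (k + 1))).indicator 1 x with hS₂
    have hle₁ : ∀ k, x ∈ N k → ENNReal.ofReal (t (k + 1)) ≤ S₁ := fun k hk => by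
      refine le_trans ?_ (ENNReal.le_tsum k)
      simp [hk]
    have hle₂ : ∀ k, x ∈ Icc (c k) (c (k + 1)) → ENNReal.ofReal (t (k + 1)) ≤ S₂ := fun k hk => by
      refine le_trans ?_ (ENNReal.le_tsum k)
      rw [indicator_of_mem hk]
      simp
    -- As c k tends to b, a point of all the level sets is in N k for all large k, which makes the
    -- first sum infinite.
    have hex : S₁ ≠ ⊤ → ∃ k, x ∉ backSet ν (t k) := by
      intro hS
      obtain ⟨k, hk₁, hk₂⟩ := ((hcb x hx.2).and
        ((httop.comp (tendsto_add_atTop_nat 1)).eventually_gt_atTop S₁.toReal)).exists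
      refine ⟨k, fun hk => ?_⟩
      have h1 := hle₁ k ⟨hk, hx.1, hk₁⟩
      rw [← ENNReal.ofReal_toReal hS, ENNReal.ofReal_le_ofReal_iff ENNReal.toReal_nonneg] at h1
      exact h1.not_gt hk₂
    by_cases hS : S₁ = ⊤
    · simp [hS]
    classical
    have hk := Nat.find_spec (hex hS)
    have hmin := fun m => Nat.find_min (hex hS) (m := m)
    set k := Nat.find (hex hS)
    have hM : backMax ν x ≤ ENNReal.ofReal (t k) := not_lt.1 fun hlt =>
      hk ((lt_backMax_iff (htpos k).le).1 hlt)
    rcases hkk : k with _ | m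
    · rw [hkk] at hM
      refine hM.trans (le_trans (le_of_eq ?_) le_self_add)
      simp [ht]
    · have hm : x ∈ backSet ν (t m) := not_not.1 (hmin m (by omega))
      rw [hkk] at hk hM
      refine hM.trans (le_trans ?_ le_add_self)
      rcases lt_or_ge x (c m) with hxm | hxm
      · exact (hle₁ m ⟨hm, hx.1, hxm⟩).trans le_self_add
      · refine (hle₂ m ⟨hxm, ?_⟩).trans le_add_self
        by_contra! hlt
        exact hk (hcsub (m + 1) ⟨hlt, hx.2⟩)
  have hsumc : ∑' k, μ (Ico (c k) (c (k + 1))) ≤ μ (Ioo a b) := by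
    have hd : Pairwise (Function.onFun Disjoint fun k => Ico (c k) (c (k + 1))) := by
      simpa using hcmono.pairwise_disjoint_on_Ico_succ
    rw [← measure_iUnion hd fun _ => measurableSet_Ico, Ioo_ae_eq_Ico.measure_eq]
    refine measure_mono (iUnion_subset fun k x hx => ⟨(hcI k).1.trans hx.1, ?_⟩)
    exact hx.2.trans_le (hcI _).2
  have hsumN : ∑' k, μ (N k) ≤ ENNReal.ofReal (2 / (1 - η)) * μ (Ioo a b) :=
    tsum_le_of_le_mul_add hη hfin (measure_mono fun x hx => ⟨hx.2.1, hx.2.2.trans_le (hcI 0).2⟩)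
      hstep hsumc
  have hlin : ∀ A : ℕ → Set ℝ, (∀ k, MeasurableSet (A k)) →
      ∫⁻ x in Ioo a b, ∑' k, ENNReal.ofReal (t (k + 1)) * (A k).indicator 1 x ≤
        ENNReal.ofReal ε⁻¹ * ∑' k, ENNReal.ofReal (t k) * volume (A k) := by
    intro A hA
    rw [lintegral_tsum fun k => by
      exact ((measurable_one.indicator (hA k)).const_mul _).aemeasurable, ← ENNReal.tsum_mul_left]
    refine ENNReal.tsum_le_tsum fun k => ?_
    rw [lintegral_const_mul _ (measurable_one.indicator (hA k)), lintegral_indicator_one (hA k),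
      htsucc, ENNReal.ofReal_mul (by linarith), mul_assoc]
    gcongr
    exact Measure.restrict_le_self
  have hl' : ENNReal.ofReal l * volume (Ioo a b) = μ (Ioo a b) := by
    rw [Real.volume_Ioo, ← ENNReal.ofReal_mul hlpos.le, hl, div_mul_cancel₀ _ hba.ne',
      measureReal_def, ENNReal.ofReal_toReal hfin]
  calc ∫⁻ x in Ioo a b, backMax ν x ≤ ∫⁻ x in Ioo a b, (ENNReal.ofReal l +
      (∑' k, ENNReal.ofReal (t (k + 1)) * (N k).indicator 1 x +
        ∑' k, ENNReal.ofReal (t (k + 1)) * (Icc (c k) (c (k + 1))).indicator 1 x)) :=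
        setLIntegral_mono' measurableSet_Ioo hpt
    _ = ENNReal.ofReal l * volume (Ioo a b) +
      ((∫⁻ x in Ioo a b, ∑' k, ENNReal.ofReal (t (k + 1)) * (N k).indicator 1 x) +
        ∫⁻ x in Ioo a b, ∑' k, ENNReal.ofReal (t (k + 1)) *
          (Icc (c k) (c (k + 1))).indicator 1 x) := by
        rw [lintegral_add_left measurable_const, lintegral_add_left, setLIntegral_const]
        exact Measurable.tsum fun k =>
          (measurable_one.indicator (hNo k).measurableSet).const_mul _
    _ ≤ μ (Ioo a b) + (ENNReal.ofReal ε⁻¹ * (ENNReal.ofReal (2 / (1 - η)) * μ (Ioo a b)) +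
        ENNReal.ofReal ε⁻¹ * μ (Ioo a b)) := by
        rw [hl']
        gcongr
        · refine (hlin N fun k => (hNo k).measurableSet).trans ?_
          gcongr
          exact (ENNReal.tsum_le_tsum htN).trans hsumN
        · refine (hlin _ fun k => measurableSet_Icc).trans ?_
          gcongr
          exact (ENNReal.tsum_le_tsum htc).trans hsumc
    _ = _ := by ring

/-! ### From integrability of the backward maximal function to the sparse bound -/

lemma backMax_mono {ν₁ ν₂ : Measure ℝ} (h : ν₁ ≤ ν₂) (x : ℝ) : backMax ν₁ x ≤ backMax ν₂ x :=
  iSup₂_mono fun _ _ => ENNReal.div_le_div_right (h _) _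

/-- If x is in the top level set, the whole geometric sum is below that level; otherwise the top
term vanishes. -/
lemma sum_indicator_backSet_le_backMax {ν : Measure ℝ} [IsLocallyFiniteMeasure ν] {l : ℝ}
    (hl : 0 ≤ l) (n : ℕ) (x : ℝ) :
    ∑ k ∈ Finset.range n, ENNReal.ofReal (2 ^ k * l) *
      (backSet ν (2 ^ (k + 1) * l)).indicator 1 x ≤ backMax ν x := by
  induction n with
  | zero => simp
  | succ n ih =>
    by_cases hx : x ∈ backSet ν (2 ^ (n + 1) * l)
    · refine le_trans ?_ ((lt_backMax_iff (by positivity)).2 hx).le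
      have hsum : ∀ m : ℕ, ∑ k ∈ Finset.range m, (2 : ℝ) ^ k * l ≤ 2 ^ m * l := by
        intro m
        induction m with
        | zero => simpa using hl
        | succ m ihm =>
          rw [Finset.sum_range_succ, pow_succ]
          linarith
      refine le_trans ?_ (ENNReal.ofReal_le_ofReal (hsum (n + 1)))
      rw [ENNReal.ofReal_sum_of_nonneg fun k _ => by positivity]
      refine Finset.sum_le_sum fun k _ => ?_
      refine mul_le_of_le_one_right' ?_
      exact indicator_le_self _ _ _
    · rw [Finset.sum_range_succ, indicator_of_notMem hx, mul_zero, add_zero]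
      exact ih

/-- A layer-cake bound in the spirit of L log L: each of n dyadic levels contributes to the integral
of M⁻ at least half of the mass of the highest level set. The gap (b, c) lets the averages fall to
l, so that no level set contains c and its components in (a, c) have right end points outside it. -/
lemma nsmul_measure_backSet_le_lintegral_backMax [IsLocallyFiniteMeasure μ]
    [NullSingletonClass μ] {a b c l : ℝ} (hbc : b < c) (hl : 0 < l)
    (hμl : μ.real (Ioo a b) ≤ l * (c - b)) (n : ℕ) :
    n * μ (backSet (μ.restrict (Ioo a b)) (2 ^ n * l) ∩ Ioo a b) ≤
      2 * ∫⁻ x in Ioo a c, backMax (μ.restrict (Ioo a c)) x := by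
  set ν := μ.restrict (Ioo a b) with hν
  set Ω : ℕ → Set ℝ := fun k => backSet ν (2 ^ k * l) with hΩ
  have hΩo : ∀ k, IsOpen (Ω k) := fun k => isOpen_backSet _ _
  have htpos : ∀ k : ℕ, 0 < 2 ^ k * l := fun k => by positivity
  have hlt : ∀ k : ℕ, l ≤ 2 ^ k * l := fun k =>
    le_mul_of_one_le_left hl.le (one_le_pow₀ one_le_two)
  have ha : ∀ k, a ∉ Ω k := fun k => notMem_backSet_of_le (htpos k).le le_rfl
  have hc : ∀ k, c ∉ Ω k := by
    intro k
    rw [hΩ, notMem_backSet]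
    intro y hy
    rw [hν, measureReal_restrict_apply measurableSet_Ioo]
    rcases le_or_gt y b with hyb | hyb
    · calc μ.real (Ioo y c ∩ Ioo a b) ≤ μ.real (Ioo a b) :=
            measureReal_mono inter_subset_right measure_Ioo_lt_top.ne
        _ ≤ l * (c - b) := hμl
        _ ≤ 2 ^ k * l * (c - y) :=
            mul_le_mul (hlt k) (by linarith) (sub_pos.2 hbc).le (htpos k).le
    · have : Ioo y c ∩ Ioo a b = ∅ :=
        eq_empty_of_forall_notMem fun z hz => (hyb.trans hz.1.1).not_gt hz.2.2
      rw [this, measureReal_empty]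
      exact mul_nonneg (htpos k).le (sub_pos.2 hy).le
  have hvol : ∀ k, ν (Ω k ∩ Ioo a c) ≤ ENNReal.ofReal (2 ^ k * l) * volume (Ω k ∩ Ioo a c) := by
    intro k
    have := measure_inter_Ioo_le_of_forall_component (hΩo k) (ha k) (hc k) ν
      (ENNReal.ofReal (2 ^ k * l) • volume) ?_
    · simpa using this
    intro x d _ hxd _ _ _ hd
    have h1 := notMem_backSet.1 hd x hxd
    have := ofReal_mul_le_of_real (μ₁ := ν) (μ₂ := volume) (A := Ioo x d) (B := Ioo x d)
      zero_le_one (htpos k).le measure_Ioo_lt_top.ne measure_Ioo_lt_top.ne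
      (by rw [Real.volume_real_Ioo_of_le hxd.le]; linarith)
    simpa using this
  have hterm : ∀ k ∈ Finset.range n, μ (Ω n ∩ Ioo a b) ≤
      2 * (ENNReal.ofReal (2 ^ k * l) * volume (Ω (k + 1) ∩ Ioo a c)) := by
    intro k hk
    have hkn : k + 1 ≤ n := Finset.mem_range.1 hk
    have h2 : (2 : ENNReal) * ENNReal.ofReal (2 ^ k * l) = ENNReal.ofReal (2 ^ (k + 1) * l) := by
      rw [pow_succ', mul_assoc, ENNReal.ofReal_mul zero_le_two, ENNReal.ofReal_ofNat]
    rw [← mul_assoc, h2]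
    refine le_trans ?_ (hvol (k + 1))
    rw [hν, Measure.restrict_apply ((hΩo _).inter isOpen_Ioo).measurableSet]
    refine measure_mono fun x hx => ⟨⟨backSet_anti ?_ hx.1, hx.2.1, hx.2.2.trans hbc⟩, hx.2⟩
    exact mul_le_mul_of_nonneg_right (pow_le_pow_right₀ one_le_two hkn) hl.le
  calc n * μ (Ω n ∩ Ioo a b) = ∑ _k ∈ Finset.range n, μ (Ω n ∩ Ioo a b) := by simp
    _ ≤ ∑ k ∈ Finset.range n, 2 * (ENNReal.ofReal (2 ^ k * l) * volume (Ω (k + 1) ∩ Ioo a c)) :=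
        Finset.sum_le_sum hterm
    _ = 2 * ∫⁻ x in Ioo a c, ∑ k ∈ Finset.range n, ENNReal.ofReal (2 ^ k * l) *
          (Ω (k + 1)).indicator 1 x := by
        rw [← Finset.mul_sum, lintegral_finsetSum _ fun k _ =>
          (measurable_one.indicator (hΩo _).measurableSet).const_mul _]
        congr 1
        refine Finset.sum_congr rfl fun k _ => ?_
        rw [lintegral_const_mul _ (measurable_one.indicator (hΩo _).measurableSet),
          lintegral_indicator_one (hΩo _).measurableSet,
          Measure.restrict_apply (hΩo _).measurableSet]
    _ ≤ 2 * ∫⁻ x in Ioo a c, backMax (μ.restrict (Ioo a c)) x := by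
        gcongr with x
        refine (sum_indicator_backSet_le_backMax hl.le n x).trans (backMax_mono ?_ x)
        exact Measure.restrict_mono (Ioo_subset_Ioo_right hbc.le) le_rfl

/-- If the local backward maximal function is integrable with a uniform bound, then sets which are
small compared with the gap to the right of them carry little mass. -/
lemma exists_measureReal_le_of_volumeReal_le [IsLocallyFiniteMeasure μ] (hμ : μ ≪ volume)
    {C : ENNReal} (hC : C ≠ ⊤) (h : ∀ a b : ℝ, a < b →
      ∫⁻ x in Ioo a b, backMax (μ.restrict (Ioo a b)) x ≤ C * μ (Ioo a b)) :
    ∃ s ∈ Ioo (0 : ℝ) 1, ∀ a b c : ℝ, a < b → b < c → ∀ F ⊆ Ioo a b, MeasurableSet F →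
      volume.real F ≤ s * (c - b) → μ.real F ≤ 1 / 4 * μ.real (Ioo a c) := by
  have := nullSingletonClass_of_absolutelyContinuous hμ
  obtain ⟨n, hn⟩ := exists_nat_gt (16 * C.toReal)
  have hnpos : (0 : ℝ) < n := lt_of_le_of_lt (by positivity) hn
  -- The quarter is split into eighths: n > 16 C gives 2C / n ≤ 1/8 for the high level set, and on
  -- the rest density at most 2^n l times |F| ≤ s (c - b) gives at most 1/8.
  refine ⟨1 / (8 * 2 ^ n), ⟨by positivity, ?_⟩, ?_⟩
  · rw [div_lt_one (by positivity)]
    linarith [one_le_pow₀ (M₀ := ℝ) one_le_two (n := n)]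
  intro a b c hab hbc F hF hFm hFs
  have hcb : 0 < c - b := sub_pos.2 hbc
  have hmono : μ.real (Ioo a b) ≤ μ.real (Ioo a c) :=
    measureReal_mono (Ioo_subset_Ioo_right hbc.le) measure_Ioo_lt_top.ne
  rcases (measureReal_nonneg (μ := μ) (s := Ioo a b)).eq_or_lt with h0 | hpos
  · have h1 : μ.real F ≤ μ.real (Ioo a b) := measureReal_mono hF measure_Ioo_lt_top.ne
    linarith
  set l := μ.real (Ioo a b) / (c - b) with hl
  have hlpos : 0 < l := div_pos hpos hcb
  set Ω := backSet (μ.restrict (Ioo a b)) (2 ^ n * l) with hΩ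
  have hΩm : MeasurableSet Ω := (isOpen_backSet _ _).measurableSet
  have h1 : n * μ.real (Ω ∩ Ioo a b) ≤ 2 * C.toReal * μ.real (Ioo a c) := by
    have h2 := (nsmul_measure_backSet_le_lintegral_backMax hbc hlpos
      (by rw [hl, div_mul_cancel₀ _ hcb.ne']) n).trans
      (mul_le_mul_right (h a c (hab.trans hbc)) 2)
    refine real_mul_le_of_ofReal hnpos.le (by positivity) measure_Ioo_lt_top.ne ?_
    rw [ENNReal.ofReal_natCast, ENNReal.ofReal_mul zero_le_two, ENNReal.ofReal_toReal hC,
      ENNReal.ofReal_ofNat, mul_assoc]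
    exact h2
  have h2 : μ.real (Ω ∩ Ioo a b) ≤ 1 / 8 * μ.real (Ioo a c) := by
    refine le_of_mul_le_mul_left (h1.trans ?_) hnpos
    nlinarith [hpos.trans_le hmono]
  have h3 : μ.real (F \ Ω) ≤ 1 / 8 * μ.real (Ioo a c) := by
    have hd := measure_le_of_disjoint_backSet (ν := μ.restrict (Ioo a b))
      (Measure.restrict_le_self.absolutelyContinuous.trans hμ) (hFm.diff hΩm) disjoint_sdiff_left
    rw [Measure.restrict_apply (hFm.diff hΩm), inter_eq_left.2 (sdiff_subset.trans hF)] at hd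
    have hd' := real_mul_le_of_ofReal (s := 1) zero_le_one (show 0 ≤ 2 ^ n * l by positivity)
      (measure_ne_top_of_subset (sdiff_subset.trans hF) measure_Ioo_lt_top.ne) (by simpa using hd)
    calc μ.real (F \ Ω) ≤ 2 ^ n * l * volume.real (F \ Ω) := by simpa using hd'
      _ ≤ 2 ^ n * l * (1 / (8 * 2 ^ n) * (c - b)) := by
          gcongr
          exact (measureReal_mono sdiff_subset
            (measure_ne_top_of_subset hF measure_Ioo_lt_top.ne)).trans hFs
      _ = 1 / 8 * μ.real (Ioo a b) := by
          rw [hl]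
          field_simp
      _ ≤ _ := by gcongr
  have h4 := measureReal_inter_add_sdiff (μ := μ) (s := F) hΩm
    (measure_ne_top_of_subset hF measure_Ioo_lt_top.ne)
  have h5 : μ.real (F ∩ Ω) ≤ μ.real (Ω ∩ Ioo a b) :=
    measureReal_mono (fun x hx => ⟨hx.2, hF hx.1⟩)
      (measure_ne_top_of_subset inter_subset_right measure_Ioo_lt_top.ne)
  linarith

/-- A uniform bound for the integral of the local backward maximal function implies the bound for
sparse sets, through a Whitney decomposition with respect to the right end point. -/
lemma exists_sparseBound_of_lintegral_backMax_le [IsLocallyFiniteMeasure μ] (hμ : μ ≪ volume)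
    {C : ENNReal} (hC : C ≠ ⊤) (h : ∀ a b : ℝ, a < b →
      ∫⁻ x in Ioo a b, backMax (μ.restrict (Ioo a b)) x ≤ C * μ (Ioo a b)) :
    ∃ ε ∈ Ioo (0 : ℝ) 1, ∃ η ∈ Ioo (0 : ℝ) 1, SparseBound μ ε η := by
  have := nullSingletonClass_of_absolutelyContinuous hμ
  obtain ⟨s, hs, hsμ⟩ := exists_measureReal_le_of_volumeReal_le hμ hC h
  -- The interval (x k, b) is four times as long as the gap from x (k + 1) to x (k + 2). Each piece
  -- is charged 1/4 of itself and its successor, so the total is 1/2.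
  refine ⟨s / 4, ⟨by linarith [hs.1], by linarith [hs.2]⟩, 1 / 2, ⟨by norm_num, by norm_num⟩, ?_⟩
  intro a b F hab hF
  have hba : 0 < b - a := sub_pos.2 hab
  set x : ℕ → ℝ := fun k => b - (1 / 2) ^ k * (b - a) with hx
  have hxsucc : ∀ k, x (k + 1) - x k = (1 / 2) ^ (k + 1) * (b - a) := fun k => by
    simp only [hx, pow_succ]
    ring
  have hxlt : ∀ k, x k < x (k + 1) := fun k => by
    have : 0 < (1 / 2 : ℝ) ^ (k + 1) * (b - a) := by positivity
    linarith [hxsucc k]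
  have hxmono : Monotone x := monotone_nat_of_le_succ fun k => (hxlt k).le
  have hx0 : x 0 = a := by simp [hx]
  have hax : ∀ k, a ≤ x k := fun k => hx0 ▸ hxmono k.zero_le
  have hxb : ∀ k, x k < b := fun k => by
    have : 0 < (1 / 2 : ℝ) ^ k * (b - a) := by positivity
    simp only [hx]
    linarith
  have hcover : F ⊆ ⋃ k, F ∩ Ico (x k) (x (k + 1)) := by
    intro y hy
    have hyI := hF.subset hy
    obtain ⟨k, hk₁, hk₂⟩ := exists_nat_pow_near_of_lt_one (x := (b - y) / (b - a))
      (div_pos (sub_pos.2 hyI.2) hba) ((div_le_one hba).2 (by linarith [hyI.1]))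
      (show (0 : ℝ) < 1 / 2 by norm_num) (by norm_num)
    rw [lt_div_iff₀ hba] at hk₁
    rw [div_le_iff₀ hba] at hk₂
    refine mem_iUnion.2 ⟨k, hy, ?_, ?_⟩ <;> simp only [hx] <;> linarith
  have hpiece : ∀ k, μ (F ∩ Ico (x k) (x (k + 1))) ≤ ENNReal.ofReal (1 / 4) *
      (μ (Ico (x k) (x (k + 1))) + μ (Ico (x (k + 1)) (x (k + 1 + 1)))) := by
    intro k
    have h1 : μ (F ∩ Ico (x k) (x (k + 1))) = μ (F ∩ Ioo (x k) (x (k + 1))) :=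
      measure_congr ((ae_eq_refl F).inter Ioo_ae_eq_Ico.symm)
    have h2 : volume.real (F ∩ Ioo (x k) (x (k + 1))) ≤ s * (x (k + 1 + 1) - x (k + 1)) := by
      refine (measureReal_mono (inter_subset_inter_right _ (Ioo_subset_Ioo_right (hxb _).le))
        (measure_ne_top_of_subset inter_subset_right measure_Ioo_lt_top.ne)).trans
        ((hF.volume_le (x k) ⟨hax k, hxb k⟩).trans_eq ?_)
      rw [hxsucc]
      simp only [hx, pow_succ]
      ring
    have h3 := hsμ (x k) (x (k + 1)) (x (k + 1 + 1)) (hxlt _) (hxlt _) _ inter_subset_right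
      (hF.measurableSet.inter measurableSet_Ioo) h2
    have h4 := ofReal_mul_le_of_real (μ₁ := μ) (μ₂ := μ) zero_le_one
      (show (0 : ℝ) ≤ 1 / 4 by norm_num)
      (measure_ne_top_of_subset inter_subset_right measure_Ioo_lt_top.ne) measure_Ioo_lt_top.ne
      (by rwa [one_mul])
    rw [ENNReal.ofReal_one, one_mul, ← h1] at h4
    refine h4.trans (mul_le_mul_right ((measure_mono fun y hy => ?_).trans (measure_union_le _ _)) _)
    rcases lt_or_ge y (x (k + 1)) with hlt | hge
    · exact Or.inl ⟨hy.1.le, hlt⟩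
    · exact Or.inr ⟨hge, hy.2⟩
  have hsum : ∑' k, μ (Ico (x k) (x (k + 1))) ≤ μ (Ioo a b) := by
    have hd : Pairwise (Function.onFun Disjoint fun k => Ico (x k) (x (k + 1))) := by
      simpa using hxmono.pairwise_disjoint_on_Ico_succ
    rw [← measure_iUnion hd fun _ => measurableSet_Ico, Ioo_ae_eq_Ico.measure_eq]
    exact measure_mono (iUnion_subset fun k y hy => ⟨(hax k).trans hy.1, hy.2.trans (hxb _)⟩)
  have hsum' : ∑' k, μ (Ico (x (k + 1)) (x (k + 1 + 1))) ≤ μ (Ioo a b) :=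
    (ENNReal.tsum_comp_le_tsum_of_injective (add_left_injective 1)
      fun k => μ (Ico (x k) (x (k + 1)))).trans hsum
  have hmain : μ F ≤ ENNReal.ofReal (1 / 2) * μ (Ioo a b) := by
    calc μ F ≤ ∑' k, μ (F ∩ Ico (x k) (x (k + 1))) :=
          (measure_mono hcover).trans (measure_iUnion_le _)
      _ ≤ ∑' k, ENNReal.ofReal (1 / 4) *
          (μ (Ico (x k) (x (k + 1))) + μ (Ico (x (k + 1)) (x (k + 1 + 1)))) :=
          ENNReal.tsum_le_tsum hpiece
      _ ≤ ENNReal.ofReal (1 / 4) * (μ (Ioo a b) + μ (Ioo a b)) := by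
          rw [ENNReal.tsum_mul_left, ENNReal.tsum_add]
          gcongr
      _ = ENNReal.ofReal (1 / 2) * μ (Ioo a b) := by
          rw [← two_mul, ← mul_assoc, ← ENNReal.ofReal_ofNat, ← ENNReal.ofReal_mul (by norm_num)]
          norm_num
  have := real_mul_le_of_ofReal (s := 1) (t := 1 / 2) zero_le_one (by norm_num)
    measure_Ioo_lt_top.ne (by simpa using hmain)
  linarith

/-! ### Translation between weights and measures -/

section Weight

variable {w : ℝ → ℝ}

/-- The measure with density `w`. -/
noncomputable def weightMeasure (w : ℝ → ℝ) : Measure ℝ :=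
  volume.withDensity fun t => ENNReal.ofReal (w t)

lemma mass_eq_weightMeasure (E : Set ℝ) : mass w E = weightMeasure w E :=
  (withDensity_apply' _ E).symm

lemma weightMeasure_absolutelyContinuous : weightMeasure w ≪ volume :=
  withDensity_absolutelyContinuous _ _

lemma isLocallyFiniteMeasure_weightMeasure (hw : LocallyIntegrable w volume) :
    IsLocallyFiniteMeasure (weightMeasure w) := by
  refine ⟨fun x => ?_⟩
  obtain ⟨s, hs, hsw⟩ := hw x
  refine ⟨s, hs, ?_⟩
  rw [weightMeasure, withDensity_apply' _ s]
  refine lt_of_le_of_lt (lintegral_mono fun t => ?_) hsw.2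
  exact (ENNReal.ofReal_le_ofReal (le_abs_self _)).trans_eq (Real.enorm_eq_ofReal_abs _).symm

lemma maximalMinus_indicator_eq (hw : ∀ x, 0 ≤ w x) (a b x : ℝ) :
    maximalMinus ((Ioo a b).indicator w) x =
      backMax ((weightMeasure w).restrict (Ioo a b)) x := by
  have h : (fun t => ENNReal.ofReal |(Ioo a b).indicator w t|) =
      (Ioo a b).indicator fun t => ENNReal.ofReal (w t) := by
    ext t
    by_cases ht : t ∈ Ioo a b
    · simp only [indicator_of_mem ht, abs_of_nonneg (hw t)]
    · simp [indicator_of_notMem ht]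
  unfold maximalMinus backMax
  simp_rw [h, Measure.restrict_apply measurableSet_Ioo, weightMeasure, withDensity_apply',
    lintegral_indicator measurableSet_Ioo, Measure.restrict_restrict measurableSet_Ioo,
    inter_comm (Ioo a b)]

lemma memAInftyPlus_iff (hw : ∀ x, 0 ≤ w x) (hw_int : LocallyIntegrable w volume) :
    MemAInftyPlus w ↔ ∃ C : ENNReal, C ≠ ⊤ ∧ ∀ a b : ℝ, a < b →
      ∫⁻ x in Ioo a b, backMax ((weightMeasure w).restrict (Ioo a b)) x ≤
        C * weightMeasure w (Ioo a b) := by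
  have := isLocallyFiniteMeasure_weightMeasure hw_int
  have heq : fujiiWilson w = ⨆ (a : ℝ) (b : ℝ) (_ : a < b),
      (∫⁻ x in Ioo a b, backMax ((weightMeasure w).restrict (Ioo a b)) x) /
        weightMeasure w (Ioo a b) := by
    simp only [fujiiWilson, maximalMinus_indicator_eq hw, mass_eq_weightMeasure]
  constructor
  · intro h
    refine ⟨fujiiWilson w, h.ne, fun a b hab => ?_⟩
    have hle : (∫⁻ x in Ioo a b, backMax ((weightMeasure w).restrict (Ioo a b)) x) /
        weightMeasure w (Ioo a b) ≤ fujiiWilson w := by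
      rw [heq]
      exact le_iSup_of_le a (le_iSup_of_le b (le_iSup_of_le hab le_rfl))
    -- A null interval is not seen by the quotient, but there the restricted measure, and with it
    -- M⁻, vanishes.
    rcases eq_or_ne (weightMeasure w (Ioo a b)) 0 with h0 | h0
    · have : (weightMeasure w).restrict (Ioo a b) = 0 := Measure.restrict_eq_zero.2 h0
      simp [backMax, this]
    · exact (ENNReal.div_le_iff_le_mul (Or.inl h0) (Or.inl measure_Ioo_lt_top.ne)).1 hle
  · rintro ⟨C, hC, h⟩
    unfold MemAInftyPlus
    rw [heq]
    refine lt_of_le_of_lt (iSup₂_le fun a b => iSup_le fun hab => ?_) hC.lt_top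
    exact ENNReal.div_le_of_le_mul (h a b hab)

lemma measure_forwardSet_le_tauberian_mul {α : ℝ} (hα : 0 ≤ α) {E : Set ℝ} (hE : MeasurableSet E)
    (h0 : 0 < weightMeasure w E) (htop : weightMeasure w E < ⊤) :
    weightMeasure w (forwardSet (volume.restrict E) α) ≤
      tauberian w α * weightMeasure w E := by
  have hle : mass w (halo α E) / mass w E ≤ tauberian w α := by
    refine le_iSup₂_of_le E hE (le_iSup₂_of_le ?_ ?_ le_rfl) <;> rwa [mass_eq_weightMeasure]
  rw [mass_eq_weightMeasure, mass_eq_weightMeasure, halo_eq_forwardSet hE hα] at hle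
  exact (ENNReal.div_le_iff_le_mul (Or.inl h0.ne') (Or.inl htop.ne)).1 hle

lemma tauberian_le {α : ℝ} (hα : 0 ≤ α) {C : ENNReal} (h : ∀ E, MeasurableSet E →
    weightMeasure w (forwardSet (volume.restrict E) α) ≤ C * weightMeasure w E) :
    tauberian w α ≤ C := by
  refine iSup₂_le fun E hE => iSup₂_le fun _ _ => ?_
  rw [mass_eq_weightMeasure, mass_eq_weightMeasure, halo_eq_forwardSet hE hα]
  exact ENNReal.div_le_of_le_mul (h E hE)

end Weight

end OneSided

theorem theorem1p1 (w : ℝ → ℝ) (hw_nonneg : ∀ x, 0 ≤ w x)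
    (hw_int : LocallyIntegrable w volume) :
    List.TFAE
      [OneSided.MemAInftyPlus w,
       ∃ δ : ℝ, 0 < δ ∧ ∃ K : ℝ, 0 < K ∧ ∀ᶠ α : ℝ in 𝓝[<] (1 : ℝ),
         OneSided.tauberian w α - 1 ≤ ENNReal.ofReal (K * (1 - α) ^ δ),
       ∃ α₀ : ℝ, α₀ ∈ Ioo (0 : ℝ) 1 ∧ OneSided.tauberian w α₀ < ⊤] := by
  have := OneSided.isLocallyFiniteMeasure_weightMeasure hw_int
  have hac := OneSided.weightMeasure_absolutelyContinuous (w := w)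
  have hnull := OneSided.nullSingletonClass_of_absolutelyContinuous hac
  tfae_have 1 → 2 := by
    intro h
    obtain ⟨C, hC, hCle⟩ := (OneSided.memAInftyPlus_iff hw_nonneg hw_int).1 h
    obtain ⟨ε, hε, η, hη, hP⟩ := OneSided.exists_sparseBound_of_lintegral_backMax_le hac hC hCle
    obtain ⟨δ, hδ, K, hK, hb⟩ := hP.exists_rpow_bound hac hε hη
    refine ⟨δ, hδ, K, hK, ?_⟩
    filter_upwards [hb, self_mem_nhdsWithin] with α hα hα₁
    refine tsub_le_iff_left.2 ((OneSided.tauberian_le hα.1.le hα.2).trans_eq ?_)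
    rw [ENNReal.ofReal_add zero_le_one
      (mul_nonneg hK.le (Real.rpow_nonneg (sub_pos.2 hα₁).le δ)), ENNReal.ofReal_one]
  tfae_have 2 → 3 := by
    rintro ⟨δ, -, K, -, h⟩
    obtain ⟨α, hα, hα₀, hα₁⟩ := (h.and ((eventually_mem_nhdsWithin).and
      (mem_nhdsWithin_of_mem_nhds (Ioi_mem_nhds (show (0 : ℝ) < 1 by norm_num))))).exists
    refine ⟨α, ⟨hα₁, hα₀⟩, lt_of_le_of_lt (tsub_le_iff_left.1 hα) ?_⟩
    exact ENNReal.add_lt_top.2 ⟨ENNReal.one_lt_top, ENNReal.ofReal_lt_top⟩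
  tfae_have 3 → 1 := by
    rintro ⟨α, hα, hlt⟩
    obtain ⟨ε, hε, η, hη, hP⟩ := OneSided.exists_sparseBound_of_tauberian hac hα hlt.ne
      fun E hE h0 htop => OneSided.measure_forwardSet_le_tauberian_mul hα.1.le hE h0 htop
    refine (OneSided.memAInftyPlus_iff hw_nonneg hw_int).2
      ⟨_, ?_, fun a b hab => hP.lintegral_backMax_le hε hη hab⟩
    finiteness
  tfae_finish
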